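/- Let $D$ be a connected diagram on the oriented sphere $S^2$ of an oriented graph such that, around every vertex, the entering edges are consecutive, and so are the leaving edges (MOY condition). Put a small circle around each vertex. Let $\mathrm{Cr}(D)$ consist of the double points of $D$ and, for each edge end entering a vertex, the point where it meets the circle of that vertex (a circle crossing). Let $\mathrm{Re}(D)$ consist of the regions of $S^2\setminus D$ and the circle regions, one for each vertex. A double point, with both strands directed upwards, has four corners: north, south, west and east. A circle crossing, with its edge directed upwards, has three corners: north (inside the circle), west and east. Let $\delta$ be a point on an edge of $D$ adjacent to two different regions $R_u, R_v$. A (Kauffman) state is a choice, for each $C\in\mathrm{Cr}(D)$, of a corner $s(C)$ around $C$ such that every region in $\mathrm{Re}(D)\setminus\{R_u,R_v\}$ contains exactly one chosen corner and $R_u,R_v$ contain none; $S(D,\delta)$ is the set of states. Fix numberings of the crossings and of the regions other than $R_u,R_v$, and let $\mathrm{sign}(s)=\pm1$ be the sign of the resulting permutation. For a corner $\triangle$ define local contributions as follows. At a double point: $m=-1,-1,1,1$ and $M=-1,1,1,1$ for the north, south, west, east corner. At a circle crossing: $m=1,-1,1$ and $M=1,1,1$ for the north, west, east corner. For a balanced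 coloring $c$ (integers on the edges whose sums over the entering and over the leaving edges at each vertex agree): at a positive crossing with over-strand of color $i$, $A=t^{i},1,t^{i},1$ for north, south, west, east; at a negative crossing with over-strand of color $i$, $A=t^{-i},1,1,t^{-i}$ for north, south, west, east; at a circle crossing on an edge of color $i$, $A=t^{i/2}-t^{-i/2},\ t^{i/2},\ t^{-i/2}$ for north, west, east. Put $m(s)=\prod_{C} m^{s(C)}$, $M(s)=\prod_{C} M^{s(C)}$ and $A(s)=\prod_{C} A^{s(C)}$, the products being over $C\in\mathrm{Cr}(D)$. Then: 1. For all states $s_1,s_2\in S(D,\delta)$, $$\frac{\mathrm{sign}(s_1)}{\mathrm{sign}(s_2)}=\frac{M(s_1)\,m(s_1)}{M(s_2)\,m(s_2)}.$$ 2. There is $\varepsilon\in\{1,-1\}$ such that $\mathrm{sign}(s)=\varepsilon\prod_{C} M^{s(C)}m^{s(C)}$ for every state $s$, and, with the same $\varepsilon$ for every balanced coloring $c$, $$\sum_{s\in S(D,\delta)}\mathrm{sign}(s)\,m(s)\,A(s)=\varepsilon\sum_{s\in S(D,\delta)}M(s)\,A(s).$$ -/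

import Mathlib

open scoped BigOperators LaurentPolynomial

noncomputable section

universe u

/-- The kinds of nodes of an oriented graph diagram on the sphere: a vertex of the graph, a
positive or a negative crossing (a double point of the projection), or an ordinary point of an
edge.  Ordinary points only subdivide edges; they make closed curves without vertices and
crossings available as diagrams. -/
inductive NodeKind
  | vertex
  | positive
  | negative
  | point

/-- A connected diagram on the oriented sphere of an oriented graph satisfying the MOY condition
at its vertices, encoded as a combinatorial map.  `Dart` is the set of half-edges of the underlying
connected plane graph, whose nodes are the vertices, the double points and finitely many ordinary
points.  `rot` sends a half-edge to the next half-edge counterclockwise around the same node, and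
`flip` sends a half-edge to the other half of the same edge; so the nodes are the cycles of `rot`,
the edges are the cycles of `flip`, and the faces are the cycles of `rot⁻¹ * flip`. -/
structure GraphDiagram where
  /-- the half-edges -/
  Dart : Type u
  finite_dart : Fintype Dart
  /-- counterclockwise rotation around the nodes -/
  rot : Equiv.Perm Dart
  /-- the other half of an edge -/
  flip : Equiv.Perm Dart
  flip_flip : ∀ h, flip (flip h) = h
  flip_ne : ∀ h, flip h ≠ h
  /-- the plane graph is connected -/
  connected : MulAction.IsPretransitive (Subgroup.closure {rot, flip}) Dart
  /-- `V + F = E + 2`, where `E` is half the number of half-edges: the surface is a sphere -/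
  spherical :
    2 * (Nat.card (Quotient (Equiv.Perm.SameCycle.setoid rot)) +
      Nat.card (Quotient (Equiv.Perm.SameCycle.setoid (rot⁻¹ * flip)))) = Nat.card Dart + 4
  /-- the kind of each node -/
  kind : Quotient (Equiv.Perm.SameCycle.setoid rot) → NodeKind
  /-- `out h = true` if the half-edge `h` is directed away from its node, `false` if it enters it -/
  out : Dart → Bool
  out_flip : ∀ h, out (flip h) = !out h
  /-- an ordinary point has one entering and one leaving half-edge -/
  point_spec : ∀ h, kind (Quotient.mk _ h) = .point →
    rot (rot h) = h ∧ out (rot h) = !out h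
  /-- a double point has four half-edges, and opposite ones belong to one oriented strand -/
  double_spec : ∀ h, kind (Quotient.mk _ h) = .positive ∨ kind (Quotient.mk _ h) = .negative →
    rot (rot (rot (rot h))) = h ∧ out (rot (rot h)) = !out h
  /-- the MOY condition: around a vertex, the entering half-edges are consecutive, and so are the
  leaving ones (a line separates them), so that at most one time a leaving half-edge is followed
  by an entering one -/
  vertex_spec : ∀ h h', kind (Quotient.mk _ h) = .vertex → rot.SameCycle h h' →
    out h = true → out (rot h) = false → out h' = true → out (rot h') = false → h = h'

namespace GraphDiagram

instance (D : GraphDiagram.{u}) : Fintype D.Dart := D.finite_dart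

variable (D : GraphDiagram.{u})

/-- The nodes of the diagram. -/
abbrev Node : Type u := Quotient (Equiv.Perm.SameCycle.setoid D.rot)

/-- The regions into which the diagram separates the sphere. -/
abbrev Face : Type u := Quotient (Equiv.Perm.SameCycle.setoid (D.rot⁻¹ * D.flip))

/-- The node of a half-edge. -/
def node (h : D.Dart) : D.Node := Quotient.mk _ h

/-- The face to the left of a half-edge, looking along it away from its node.  It is also the face
that contains the angular sector between `h` and `D.rot h` at the node of `h`. -/
def face (h : D.Dart) : D.Face := Quotient.mk _ h

/-- Half-edges at double points. -/
def AtDouble (h : D.Dart) : Prop :=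
  D.kind (D.node h) = .positive ∨ D.kind (D.node h) = .negative

/-- Half-edges that enter a vertex of the graph. -/
def EntersVertex (h : D.Dart) : Prop :=
  D.kind (D.node h) = .vertex ∧ D.out h = false

/-- The set `Cr(D)`: the double points, and one crossing for each edge end entering a vertex
(the point where it meets the boundary of the circle region around the vertex). -/
def Crossing : Type u :=
  {v : D.Node // D.kind v = .positive ∨ D.kind v = .negative} ⊕ {h : D.Dart // D.EntersVertex h}

/-- The set `Re(D)`: the faces of the diagram and one circle region for each vertex. -/
def Region : Type u :=
  D.Face ⊕ {v : D.Node // D.kind v = .vertex}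

end GraphDiagram

/-- Positions of the corners around a double point, both strands directed upwards. -/
inductive Compass
  | north
  | west
  | south
  | east

/-- Positions of the three corners around the crossing of an edge entering a circle region, the
edge directed upwards: inside the circle, to the left and to the right of the edge. -/
inductive CircleCompass
  | north
  | west
  | east

namespace GraphDiagram

variable (D : GraphDiagram.{u})

/-- The corners of the diagram.  A corner at a double point is the sector between `h` and
`D.rot h`, and is recorded by `h`. -/
def Corner : Type u :=
  {h : D.Dart // D.AtDouble h} ⊕ ({h : D.Dart // D.EntersVertex h} × CircleCompass)

variable {D}

/-- The crossing around which a corner lies. -/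
def Corner.crossing : D.Corner → D.Crossing
  | .inl h => .inl ⟨D.node h.1, h.2⟩
  | .inr (h, _) => .inr h

/-- The region that contains a corner. -/
def Corner.region : D.Corner → D.Region
  | .inl h => .inl (D.face h.1)
  | .inr (h, .north) => .inr ⟨D.node h.1, h.2.1⟩
  | .inr (h, .west) => .inl (D.face (D.rot⁻¹ h.1))
  | .inr (h, .east) => .inl (D.face h.1)

variable (D) in
/-- The position of the sector between `h` and `D.rot h` at a double point: north lies between the
two leaving half-edges, south between the two entering ones, and west and east lie to the left and
to the right. -/
def compass (h : D.Dart) : Compass :=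
  match D.out h, D.out (D.rot h) with
  | true, true => .north
  | true, false => .west
  | false, false => .south
  | false, true => .east

/-- The local contribution `m` to the Alexander matrix. -/
def Corner.m : D.Corner → ℤˣ
  | .inl h =>
    match D.compass h.1 with
    | .north => -1
    | .west => 1
    | .south => -1
    | .east => 1
  | .inr (_, .north) => 1
  | .inr (_, .west) => -1
  | .inr (_, .east) => 1

/-- The local contribution `M`. -/
def Corner.M : D.Corner → ℤˣ
  | .inl h =>
    match D.compass h.1 with
    | .north => -1
    | .west => 1
    | .south => 1
    | .east => 1
  | .inr _ => 1

/-- The local contribution to the sign of a state. -/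
def Corner.localSign (a : D.Corner) : ℤˣ := a.M * a.m

variable (D) in
open Classical in
/-- Balanced colorings: integers on the edges of the graph (so constant along strands of the
diagram) with equal sums over entering and leaving edges at each vertex. -/
structure Coloring where
  /-- the color of the edge to which a half-edge belongs -/
  color : D.Dart → ℤ
  color_flip : ∀ h, color (D.flip h) = color h
  color_point : ∀ h, D.kind (D.node h) = .point → color (D.rot h) = color h
  color_double : ∀ h, D.AtDouble h → color (D.rot (D.rot h)) = color h
  balanced : ∀ v : D.Node, D.kind v = .vertex →
    ∑ h with D.node h = v ∧ D.out h = false, color h =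
      ∑ h with D.node h = v ∧ D.out h = true, color h

open Classical in
/-- The color of the strand passing over at a double point, read off at the corner `h` there.  With
both strands directed upwards, the over-strand of a positive crossing goes from the bottom left to
the top right, and that of a negative crossing from the bottom right to the top left. -/
def Coloring.over (c : D.Coloring) (h : D.Dart) : ℤ :=
  if D.kind (D.node h) = .positive then
    match D.compass h with
    | .north | .south => c.color h
    | .west | .east => c.color (D.rot h)
  else
    match D.compass h with
    | .north | .south => c.color (D.rot h)
    | .west | .east => c.color h

open Classical in
/-- The local contribution `A`, a Laurent polynomial in `LaurentPolynomial.T 1`, which stands for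
the variable `t ^ (1 / 2)`; thus `t ^ (k / 2)` is `LaurentPolynomial.T k`. -/
def Corner.A (c : D.Coloring) : D.Corner → ℤ[T;T⁻¹]
  | .inl h =>
    if D.kind (D.node h.1) = .positive then
      match D.compass h.1 with
      | .north | .west => LaurentPolynomial.T (2 * c.over h.1)
      | .south | .east => 1
    else
      match D.compass h.1 with
      | .north | .east => LaurentPolynomial.T (-(2 * c.over h.1))
      | .south | .west => 1
  | .inr (h, .north) =>
    LaurentPolynomial.T (c.color h.1) - LaurentPolynomial.T (-c.color h.1)
  | .inr (h, .west) => LaurentPolynomial.T (c.color h.1)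
  | .inr (h, .east) => LaurentPolynomial.T (-c.color h.1)

/-- The regions other than the two adjacent to the edge of the half-edge `δ`. -/
def Unmarked (δ : D.Dart) : Type u :=
  {r : D.Region // r ≠ .inl (D.face δ) ∧ r ≠ .inl (D.face (D.flip δ))}

/-- Kauffman states of the diagram with an initial point on the edge of `δ`: each crossing is
assigned one of the corners around it, so that each unmarked region contains exactly one assigned
corner and the marked regions contain none. -/
structure State (δ : D.Dart) where
  /-- the corner assigned to a crossing -/
  corner : D.Crossing → D.Corner
  crossing_corner : ∀ C, (corner C).crossing = C
  unmarked : ∀ C, (corner C).region ≠ .inl (D.face δ) ∧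
    (corner C).region ≠ .inl (D.face (D.flip δ))
  bijective : Function.Bijective
    (fun C => (⟨(corner C).region, unmarked C⟩ : Unmarked δ))

instance : Finite CircleCompass :=
  Finite.of_surjective (fun i : Fin 3 => (![.north, .west, .east] i : CircleCompass))
    (by intro c; cases c
        exacts [⟨0, rfl⟩, ⟨1, rfl⟩, ⟨2, rfl⟩])

instance : Fintype D.Crossing := by
  unfold Crossing
  exact Fintype.ofFinite _

instance : Finite D.Corner := by
  unfold Corner
  infer_instance

instance (δ : D.Dart) : Fintype (State δ) :=
  haveI : Finite (State δ) := Finite.of_injective (fun s : State δ => s.corner) (by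
    rintro ⟨a, _, _, _⟩ ⟨b, _, _, _⟩ h
    cases h
    rfl)
  Fintype.ofFinite _

namespace State

variable {δ : D.Dart}

/-- A state as a bijection from the crossings to the unmarked regions. -/
def equiv (s : State δ) : D.Crossing ≃ Unmarked δ := Equiv.ofBijective _ s.bijective

/-- The sign of a state as a permutation, with respect to a numbering of the crossings and a
numbering of the unmarked regions. -/
def sign {N : ℕ} (cr : Fin N ≃ D.Crossing) (re : Fin N ≃ Unmarked δ) (s : State δ) : ℤˣ :=
  Equiv.Perm.sign ((cr.trans s.equiv).trans re.symm)

/-- The product of the local contributions `m`. -/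
def m (s : State δ) : ℤˣ := ∏ C, (s.corner C).m

/-- The product of the local contributions `M`. -/
def M (s : State δ) : ℤˣ := ∏ C, (s.corner C).M

/-- The product of the local contributions `A`. -/
def A (c : D.Coloring) (s : State δ) : ℤ[T;T⁻¹] := ∏ C, (s.corner C).A c

end State

end GraphDiagram

end

-- The corners are the edges of a plane bipartite graph with the crossings as black and the regions
-- as white vertices. A state is a matching of all black vertices with all white ones but the two
-- marked. The claim is Kasteleyn's: up to a common factor, the sign of a matching is the product of
-- signs `M * m` on its edges.
--
-- Each vertex is blown up to a circle. This adds crossings on leaving edge ends; they and the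
-- ordinary points stay unmatched. A half-edge of the blown-up map stands for the corner after it.
-- With `ρ` the rotation and `c` the edge involution, black vertices are the cycles of `ρ`, white
-- ones those of `c⁻¹ * ρ`, and the faces of the bipartite graph are the cycles of `c`.
--
-- Two states differ by a cycle mod 2, which bounds a set `F` of faces since the surface is a sphere
-- (`BlowDart.exists_boundary`). Exchanging the two matchings turns `ρ` and `c⁻¹ * ρ` into
-- permutations of `F` whose cycles are the vertices that `F` touches. Since the product of the two
-- exchanges has on `F` the sign of the permutation `σ` relating the states, counting cycles gives
-- `sign σ` as the sign of `c` on `F` times `(-1)` to the number of vertices touched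
-- (`CutPair.sign_eq`).
--
-- The product of the edge signs of both states is a product over `F`. By `weight_mul_weight` it
-- contributes the sign of `c` on `F` and a sign for each unmatched black vertex touched. Matched
-- black and white vertices touched are equal in number, and the marked regions are touched
-- together, so the two signs agree (`CutPair.sign_eq_prod`). The state sum identity then follows
-- from `m * m = 1`.

universe u

noncomputable section

open Equiv Equiv.Perm

/-! ### Signs and numbers of cycles -/

namespace Equiv.Perm

/-- The sign of a permutation in terms of the number of its cycles, the cycles being the fibers
of a surjection. -/
theorem sign_of_fibers {S X : Type*} [Fintype S] [DecidableEq S] [Fintype X] (π : Perm S)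
    (f : S → X) (hf : Function.Surjective f) (h : ∀ s s', f s = f s' ↔ π.SameCycle s s') :
    sign π = (-1) ^ (Fintype.card S + Fintype.card X) := by
  classical
  obtain ⟨r, hr⟩ := hf.hasRightInverse
  have h1 : (Finset.univ.filter fun x => r x ∈ π.support).card = π.cycleFactorsFinset.card := by
    refine Finset.card_bij (fun x _ => π.cycleOf (r x)) ?_ ?_ ?_
    · intro x hx
      simpa [cycleOf_mem_cycleFactorsFinset_iff] using hx
    · intro x hx y hy hxy
      have hx' : r x ∈ (π.cycleOf (r x)).support := by
        simpa [mem_support, cycleOf_apply_self] using hx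
      rw [hxy, mem_support_cycleOf_iff] at hx'
      rw [← hr x, ← hr y]
      exact ((h _ _).2 hx'.1).symm
    · intro g hg
      obtain ⟨a, ha⟩ := (mem_cycleFactorsFinset_iff.1 hg).1.nonempty_support
      have hg' := (cycle_is_cycleOf ha hg)
      have hra : π.SameCycle (r (f a)) a := (h _ _).1 (hr _)
      have hcyc : π.cycleOf (r (f a)) = g := by rw [hra.cycleOf_eq, hg']
      refine ⟨f a, ?_, hcyc⟩
      simp only [Finset.mem_filter, Finset.mem_univ, true_and]
      rw [← cycleOf_mem_cycleFactorsFinset_iff, hcyc]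
      exact hg
  have h2 : (Finset.univ.filter fun x => ¬ r x ∈ π.support).card = π.supportᶜ.card := by
    refine Finset.card_bij (fun x _ => r x) ?_ ?_ ?_
    · intro x hx
      simpa using hx
    · intro x _ y _ hxy
      exact hr.injective hxy
    · intro a ha
      have hfix : π a = a := by simpa using ha
      have hra : r (f a) = a :=
        ((h _ _).1 (hr (f a))).eq_of_right hfix
      exact ⟨f a, by simp [hra, hfix], hra⟩
  have h3 := Finset.card_filter_add_card_filter_not (s := (Finset.univ : Finset X))
    (fun x => r x ∈ π.support)
  rw [h1, h2, Finset.card_univ] at h3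
  have h4 := Finset.card_add_card_compl π.support
  have h5 : Multiset.card π.cycleType = π.cycleFactorsFinset.card := by
    simp [cycleType_def]
  rw [sign_of_cycleType, sum_cycleType, h5, ← h3, ← h4]
  have : π.support.card + π.supportᶜ.card + (π.cycleFactorsFinset.card + π.supportᶜ.card) =
      (π.support.card + π.cycleFactorsFinset.card) + 2 * π.supportᶜ.card := by ring
  rw [this, pow_add _ _ (2 * _), pow_mul]
  simp

end Equiv.Perm

/-! ### Exchanging two matchings -/

section Exchange

variable {E X K : Type*}

open Classical in
/-- The map that exchanges `t₁ k` and `t₂ k` for each `k`. -/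
def exchangeFun (t₁ t₂ : K → E) (d : E) : E :=
  if h : ∃ k, t₁ k = d then t₂ h.choose else if h : ∃ k, t₂ k = d then t₁ h.choose else d

variable {β : E → X} {t₁ t₂ : K → E}

theorem exchangeFun_left (h₁ : Function.Injective t₁) (k : K) :
    exchangeFun t₁ t₂ (t₁ k) = t₂ k := by
  have h : ∃ k', t₁ k' = t₁ k := ⟨k, rfl⟩
  rw [exchangeFun, dif_pos h, h₁ h.choose_spec]

/-- A point in both ranges has the same index in each, so the priority of `t₁` in `exchangeFun` does
no harm. -/
theorem exchangeFun_right (h₁₂ : ∀ k, β (t₁ k) = β (t₂ k))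
    (hβ : Function.Injective fun k => β (t₁ k)) (k : K) : exchangeFun t₁ t₂ (t₂ k) = t₁ k := by
  by_cases h : ∃ k', t₁ k' = t₂ k
  · obtain ⟨k', hk⟩ := h
    obtain rfl : k' = k := hβ (by simp only [hk, h₁₂])
    have h₁ : Function.Injective t₁ := fun a b hab => hβ (by simp only [hab])
    rw [← hk, exchangeFun_left h₁, hk]
  · have h' : ∃ k', t₂ k' = t₂ k := ⟨k, rfl⟩
    have : h'.choose = k := hβ (by simp only [h₁₂]; rw [h'.choose_spec])
    rw [exchangeFun, dif_neg h, dif_pos h', this]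

theorem exchangeFun_of_notMem {d : E} (h₁ : d ∉ Set.range t₁) (h₂ : d ∉ Set.range t₂) :
    exchangeFun t₁ t₂ d = d := by
  exact (dif_neg h₁).trans (dif_neg h₂)

theorem exchangeFun_involutive (h₁₂ : ∀ k, β (t₁ k) = β (t₂ k))
    (hβ : Function.Injective fun k => β (t₁ k)) : Function.Involutive (exchangeFun t₁ t₂) := by
  have h₁ : Function.Injective t₁ := fun a b hab => hβ (by simp only [hab])
  intro d
  by_cases hd : d ∈ Set.range t₁
  · obtain ⟨k, rfl⟩ := hd
    rw [exchangeFun_left h₁, exchangeFun_right h₁₂ hβ]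
  · by_cases hd' : d ∈ Set.range t₂
    · obtain ⟨k, rfl⟩ := hd'
      rw [exchangeFun_right h₁₂ hβ, exchangeFun_left h₁]
    · rw [exchangeFun_of_notMem hd hd', exchangeFun_of_notMem hd hd']

end Exchange

/-! ### Rotations rerouted along the boundary of a set of faces -/

/-- Two partial transversals `t₁`, `t₂` of the cycles of `ρ`, which are the fibers of `β`, such
that the set `F` is entered or left by `ρ` exactly at the points that lie in one of the two. -/
structure CutPair {E X K : Type*} (ρ : Perm E) (β : E → X) (t₁ t₂ : K → E) (F : E → Prop) :
    Prop where
  fiber : ∀ d e, β d = β e ↔ ρ.SameCycle d e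
  same : ∀ k, β (t₁ k) = β (t₂ k)
  inj : Function.Injective fun k => β (t₁ k)
  cut : ∀ d, (F d ↔ F (ρ d)) ↔ (d ∈ Set.range t₁ ↔ d ∈ Set.range t₂)

namespace CutPair

variable {E X K : Type*} {ρ : Perm E} {β : E → X} {t₁ t₂ : K → E} {F : E → Prop}

theorem symm (H : CutPair ρ β t₁ t₂ F) : CutPair ρ β t₂ t₁ F where
  fiber := H.fiber
  same k := (H.same k).symm
  inj := fun a b hab => H.inj (by simpa only [H.same] using hab)
  cut d := (H.cut d).trans Iff.comm

theorem injective_left (H : CutPair ρ β t₁ t₂ F) : Function.Injective t₁ :=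
  fun a b hab => H.inj (by simp only [hab])

/-- The permutation that exchanges the two transversals. -/
def exchange (H : CutPair ρ β t₁ t₂ F) : Perm E :=
  (exchangeFun_involutive H.same H.inj).toPerm

theorem exchange_left (H : CutPair ρ β t₁ t₂ F) (k : K) : H.exchange (t₁ k) = t₂ k :=
  exchangeFun_left H.injective_left k

theorem exchange_right (H : CutPair ρ β t₁ t₂ F) (k : K) : H.exchange (t₂ k) = t₁ k :=
  exchangeFun_right H.same H.inj k

theorem exchange_of_notMem (H : CutPair ρ β t₁ t₂ F) {d : E} (h₁ : d ∉ Set.range t₁)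
    (h₂ : d ∉ Set.range t₂) : H.exchange d = d :=
  exchangeFun_of_notMem h₁ h₂

theorem exchange_mul_self (H : CutPair ρ β t₁ t₂ F) : H.exchange * H.exchange = 1 := by
  ext d
  exact exchangeFun_involutive H.same H.inj d

theorem eq_of_mem_range (H : CutPair ρ β t₁ t₂ F) {k : K} (h : t₁ k ∈ Set.range t₂) :
    t₁ k = t₂ k := by
  obtain ⟨k', hk⟩ := h
  obtain rfl : k' = k := H.inj (by simp only [H.same k', hk])
  exact hk.symm

theorem cut_left (H : CutPair ρ β t₁ t₂ F) (k : K) :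
    (F (t₁ k) ↔ F (ρ (t₁ k))) ↔ t₁ k = t₂ k := by
  rw [H.cut]
  constructor
  · intro h
    exact H.eq_of_mem_range (h.1 ⟨k, rfl⟩)
  · intro h
    exact ⟨fun _ => ⟨k, h.symm⟩, fun _ => ⟨k, rfl⟩⟩

theorem β_apply (H : CutPair ρ β t₁ t₂ F) (d : E) : β (ρ d) = β d :=
  (H.fiber _ _).2 (sameCycle_apply_left.2 (SameCycle.refl _ _))

/-- Along a cycle of `ρ` entries into `F` and exits from it balance. In the cycle of `t₁ k` they
occur exactly at `t₁ k` and `t₂ k`, so one of these is an entry and the other an exit. -/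
theorem opposite [Fintype E] (H : CutPair ρ β t₁ t₂ F) {k : K} (hne : t₁ k ≠ t₂ k) :
    (F (t₂ k) ↔ ¬ F (t₁ k)) ∧ (F (ρ (t₂ k)) ↔ F (t₁ k)) ∧ (F (ρ (t₁ k)) ↔ ¬ F (t₁ k)) := by
  classical
  have h1 : ∑ d, (if β d = β (t₁ k) ∧ F d then (1 : ℤ) else 0) =
      ∑ d, (if β d = β (t₁ k) ∧ F (ρ d) then (1 : ℤ) else 0) := by
    rw [← Equiv.sum_comp ρ]
    simp only [H.β_apply]
  rw [← sub_eq_zero, ← Finset.sum_sub_distrib, Fintype.sum_eq_add (t₁ k) (t₂ k) hne] at h1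
  · have h2 := (H.cut_left k).not.2 hne
    have h3 := (H.symm.cut_left k).not.2 hne.symm
    simp only [H.same k, true_and] at h1
    by_cases a : F (t₁ k) <;> by_cases b : F (t₂ k) <;> by_cases c : F (ρ (t₁ k)) <;>
      by_cases e : F (ρ (t₂ k)) <;> simp_all
  · rintro d ⟨hd₁, hd₂⟩
    by_cases hd : β d = β (t₁ k)
    · have : F d ↔ F (ρ d) := by
        rw [H.cut]
        constructor
        · rintro ⟨k', rfl⟩
          exact absurd (congrArg t₁ (H.inj hd)) hd₁
        · rintro ⟨k', rfl⟩
          rw [H.same] at hd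
          exact absurd (congrArg t₂ (H.symm.inj hd)) hd₂
      simp [this]
    · simp [hd]

theorem exchange_eq_self (H : CutPair ρ β t₁ t₂ F) {d : E} (h : F d ↔ F (ρ d)) :
    H.exchange d = d := by
  by_cases hd : d ∈ Set.range t₁
  · obtain ⟨k, rfl⟩ := hd
    rw [H.exchange_left, (H.cut_left k).1 h]
  · by_cases hd' : d ∈ Set.range t₂
    · obtain ⟨k, rfl⟩ := hd'
      rw [H.exchange_right, (H.symm.cut_left k).1 h]
    · exact H.exchange_of_notMem hd hd'

theorem mem_of_not_iff (H : CutPair ρ β t₁ t₂ F) {d : E} (h : ¬ (F d ↔ F (ρ d))) :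
    ∃ k, t₁ k ≠ t₂ k ∧ (d = t₁ k ∨ d = t₂ k) := by
  by_cases hd : d ∈ Set.range t₁
  · obtain ⟨k, rfl⟩ := hd
    exact ⟨k, (H.cut_left k).not.1 h, .inl rfl⟩
  · by_cases hd' : d ∈ Set.range t₂
    · obtain ⟨k, rfl⟩ := hd'
      exact ⟨k, Ne.symm ((H.symm.cut_left k).not.1 h), .inr rfl⟩
    · exact absurd ((H.cut d).2 (by simp only [hd, hd'])) h

/-- Where `ρ` would leave `F`, the exchange first jumps to the partner, from which `ρ` enters `F`.
-/
theorem apply_exchange_iff [Fintype E] (H : CutPair ρ β t₁ t₂ F) (d : E) :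
    F ((ρ * H.exchange) d) ↔ F d := by
  rw [mul_apply]
  by_cases h : F d ↔ F (ρ d)
  · rw [H.exchange_eq_self h, h]
  · obtain ⟨k, hk, rfl | rfl⟩ := H.mem_of_not_iff h
    · rw [H.exchange_left]
      exact (H.opposite hk).2.1
    · rw [H.exchange_right]
      exact (H.symm.opposite hk.symm).2.1

theorem exit_unique [Fintype E] (H : CutPair ρ β t₁ t₂ F) {d e : E} (hde : β d = β e)
    (hd : F d) (hd' : ¬ F (ρ d)) (he : F e) (he' : ¬ F (ρ e)) : d = e := by
  obtain ⟨k, hk, h⟩ := H.mem_of_not_iff (d := d) (by tauto)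
  obtain ⟨l, hl, h'⟩ := H.mem_of_not_iff (d := e) (by tauto)
  have hkl : k = l := by
    apply H.inj
    rcases h with rfl | rfl <;> rcases h' with rfl | rfl <;> simpa only [H.same] using hde
  subst hkl
  have := H.opposite hk
  rcases h with rfl | rfl <;> rcases h' with rfl | rfl <;> first | rfl | tauto

theorem sameCycle_or_exit (H : CutPair ρ β t₁ t₂ F) {e : E} (he : F e) (n : ℕ) :
    ∀ d, F d → (ρ ^ n) d = e → (ρ * H.exchange).SameCycle d e ∨
      ∃ x, β x = β d ∧ F x ∧ ¬ F (ρ x) ∧ (ρ * H.exchange).SameCycle d x := by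
  induction n with
  | zero =>
    rintro d _ rfl
    exact .inl (SameCycle.refl _ _)
  | succ n ih =>
    intro d hd hde
    by_cases hd' : F (ρ d)
    · have h1 : (ρ * H.exchange) d = ρ d := by
        rw [mul_apply, H.exchange_eq_self (by tauto)]
      have h2 : (ρ * H.exchange).SameCycle d (ρ d) := by
        rw [← h1]
        exact sameCycle_apply_right.2 (SameCycle.refl _ _)
      rcases ih (ρ d) hd' (by rw [← hde, pow_succ, mul_apply]) with h | ⟨x, hx, h3, h4, h5⟩
      · exact .inl (h2.trans h)
      · exact .inr ⟨x, hx.trans (H.β_apply d), h3, h4, h2.trans h5⟩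
    · exact .inr ⟨d, rfl, hd, hd', SameCycle.refl _ _⟩

/-- By `exit_unique`, `F` meets a cycle of `ρ` in all of it, nothing or a single arc, and the
rerouted permutation closes the arc up. If neither of two points of the arc reaches the other, both
reach its exit. -/
theorem sameCycle_exchange [Fintype E] (H : CutPair ρ β t₁ t₂ F) {d e : E} (hd : F d) (he : F e) :
    β d = β e ↔ (ρ * H.exchange).SameCycle d e := by
  constructor
  · intro h
    obtain ⟨m, hm⟩ := ((H.fiber _ _).1 h).exists_nat_pow_eq
    obtain ⟨n, hn⟩ := ((H.fiber _ _).1 h.symm).exists_nat_pow_eq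
    rcases H.sameCycle_or_exit he m d hd hm with h' | ⟨x, hx, h1, h2, h3⟩
    · exact h'
    · rcases H.sameCycle_or_exit hd n e he hn with h' | ⟨y, hy, h4, h5, h6⟩
      · exact h'.symm
      · rw [H.exit_unique (hx.trans (h.trans hy.symm)) h1 h2 h4 h5] at h3
        exact h3.trans h6.symm
  · rintro ⟨n, rfl⟩
    have key : ∀ a, β ((ρ * H.exchange) a) = β a := by
      intro a
      rw [mul_apply, H.β_apply]
      by_cases ha : a ∈ Set.range t₁
      · obtain ⟨k, rfl⟩ := ha
        rw [H.exchange_left, H.same]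
      · by_cases ha' : a ∈ Set.range t₂
        · obtain ⟨k, rfl⟩ := ha'
          rw [H.exchange_right, H.same]
        · rw [H.exchange_of_notMem ha ha']
    have key' : ∀ (n : ℕ) a, β (((ρ * H.exchange) ^ n) a) = β a := by
      intro n
      induction n with
      | zero => intro a; rfl
      | succ n ih => intro a; rw [pow_succ, mul_apply, ih, key]
    obtain ⟨n, rfl | rfl⟩ := n.eq_nat_or_neg
    · rw [zpow_natCast, key']
    · rw [← key' n (((ρ * H.exchange) ^ (-(n : ℤ))) d), zpow_neg, zpow_natCast, ← mul_apply,
        mul_inv_cancel, one_apply]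

open Classical in
theorem sign_exchange [Fintype E] [Fintype X] (H : CutPair ρ β t₁ t₂ F) :
    sign ((ρ * H.exchange).subtypePerm (p := F) H.apply_exchange_iff) =
      (-1) ^ (Fintype.card {d // F d} + Fintype.card {x // ∃ d, F d ∧ β d = x}) := by
  refine sign_of_fibers _ (fun d => ⟨β d.1, d.1, d.2, rfl⟩) ?_ ?_
  · rintro ⟨x, d, hd, rfl⟩
    exact ⟨⟨d, hd⟩, rfl⟩
  · intro d e
    rw [sameCycle_subtypePerm, ← H.sameCycle_exchange d.2 e.2, Subtype.mk.injEq]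

end CutPair

/-! ### The sign relating two matchings, by counting cycles -/

namespace Equiv.Perm

/-- Inverting a permutation on the complement of an invariant set does not change its sign. -/
theorem sign_subtypeCongr_inv {K : Type*} [Fintype K] [DecidableEq K] (σ : Perm K) (p : K → Prop)
    [DecidablePred p] (h : ∀ k, p (σ k) ↔ p k) :
    sign ((σ.subtypePerm h).subtypeCongr
      (σ.subtypePerm (p := fun k => ¬ p k) (fun k => (h k).not))⁻¹) = sign σ := by
  rw [sign_subtypeCongr, sign_inv, ← sign_subtypeCongr]
  congr 1
  ext k
  by_cases hk : p k
  · rw [subtypeCongr.left_apply _ _ hk]; rfl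
  · rw [subtypeCongr.right_apply _ _ hk]; rfl

end Equiv.Perm

section Double

variable {E X Y K : Type*} [Fintype E] {ρ c : Perm E} {β : E → X} {γ : E → Y}
  {t₁ t₂ : K → E} {σ : Perm K} {F : E → Prop}

/-- The preservation of `F` by the composition of the two exchanges. -/
theorem CutPair.exchange_mul_exchange_iff (H : CutPair ρ β t₁ t₂ F)
    (G : CutPair (c⁻¹ * ρ) γ t₁ (t₂ ∘ σ) F) (hc : ∀ d, F (c d) ↔ F d) (d : E) :
    F ((H.exchange * G.exchange) d) ↔ F d := by
  have h1 : c * ((c⁻¹ * ρ) * G.exchange) = (ρ * H.exchange) * (H.exchange * G.exchange) := by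
    rw [mul_assoc ρ, ← mul_assoc H.exchange, H.exchange_mul_self]
    group
  rw [← H.apply_exchange_iff, ← mul_apply, ← h1, mul_apply, hc, G.apply_exchange_iff]

variable [Fintype K]

open Classical in
-- The product of the exchanges sends `t₁ k` to `t₁ (σ k)` and `t₂ k` to `t₂ (σ⁻¹ k)`. When `t₁ k ≠
-- t₂ k`, just one of them is in `F`, so on `F` it acts as `σ` on some indices and as `σ⁻¹` on the
-- others; inverting there keeps the sign.
theorem CutPair.sign_exchange_mul_exchange (H : CutPair ρ β t₁ t₂ F)
    (G : CutPair (c⁻¹ * ρ) γ t₁ (t₂ ∘ σ) F) (hc : ∀ d, F (c d) ↔ F d) :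
    sign ((H.exchange * G.exchange).subtypePerm (p := F) (H.exchange_mul_exchange_iff G hc)) =
      sign σ := by
  have hψ : ∀ d, F ((c⁻¹ * ρ) d) ↔ F (ρ d) := by
    intro d
    rw [← hc, ← mul_apply, mul_inv_cancel_left]
  have hσ₁ : ∀ k, t₁ k = t₂ k ↔ t₁ k = t₂ (σ k) := by
    intro k
    rw [← H.cut_left, ← hψ]
    exact G.cut_left k
  have hσ₂ : ∀ k, t₁ (σ k) = t₂ (σ k) ↔ t₁ k = t₂ (σ k) := by
    intro k
    rw [eq_comm, ← H.symm.cut_left, ← hψ, eq_comm]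
    exact G.symm.cut_left k
  have hG : ∀ k, t₁ k ≠ t₂ k →
      (F (t₂ (σ k)) ↔ ¬ F (t₁ k)) ∧ (F (ρ (t₂ (σ k))) ↔ F (t₁ k)) := by
    intro k hk
    have := G.opposite ((hσ₁ k).not.1 hk)
    rw [hψ] at this
    exact ⟨this.1, this.2.1⟩
  let p : K → Prop := fun k => t₁ k ≠ t₂ k ∧ F (t₁ k)
  -- Membership in `F` changes from `t₁ k` to `t₂ (σ k)` at their white vertex and changes back from
  -- there to `t₁ (σ k)` at the black one.
  have hp : ∀ k, p (σ k) ↔ p k := by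
    intro k
    have h1 : t₁ (σ k) ≠ t₂ (σ k) ↔ t₁ k ≠ t₂ k := by rw [ne_eq, hσ₂, ← hσ₁]
    simp only [p, h1]
    refine and_congr_right fun hk => ?_
    have := hG k hk
    have := H.opposite (h1.2 hk)
    tauto
  have hA₁ := H.exchange_left
  have hA₂ := H.exchange_right
  have hB₁ : ∀ k, G.exchange (t₁ k) = t₂ (σ k) := G.exchange_left
  have hB₂ : ∀ k, G.exchange (t₂ (σ k)) = t₁ k := G.exchange_right
  have hB₃ : ∀ k, G.exchange (t₂ k) = t₁ (σ⁻¹ k) := by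
    intro k
    have := hB₂ (σ⁻¹ k)
    rwa [← mul_apply, mul_inv_cancel, one_apply] at this
  rw [← sign_subtypeCongr_inv σ p hp]
  set τ := (σ.subtypePerm hp).subtypeCongr
      (σ.subtypePerm (p := fun k => ¬ p k) (fun k => (hp k).not))⁻¹ with hτ
  have hτ₁ : ∀ k, p k → τ k = σ k := fun k hk => by
    rw [hτ, subtypeCongr.left_apply _ _ hk]; rfl
  have hτ₂ : ∀ k, ¬ p k → τ k = σ⁻¹ k := fun k hk => by
    rw [hτ, subtypeCongr.right_apply _ _ hk]; rfl
  have hp' : ∀ k, p (σ⁻¹ k) ↔ p k := by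
    intro k
    rw [← hp (σ⁻¹ k), ← mul_apply, mul_inv_cancel, one_apply]
  have hne : ∀ k, τ k ≠ k → t₁ k ≠ t₂ k := by
    intro k hk h
    apply hk
    have h1 := (hσ₁ k).1 h
    have h2 : k = σ k := H.symm.injective_left (h.symm.trans h1)
    rw [hτ₂ k (fun h' => h'.1 h), inv_eq_iff_eq]
    exact h2
  symm
  refine sign_bij (fun k hk => if h : p k then ⟨t₁ k, h.2⟩ else ⟨t₂ k, by
      have := H.opposite (hne k hk)
      have h' := hne k hk
      simp only [p] at h
      tauto⟩) ?_ ?_ ?_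
  · intro k hk hk'
    by_cases h : p k
    · have h' := (hp k).2 h
      rw [← hτ₁ k h] at h'
      rw [dif_pos h', dif_pos h]
      apply Subtype.ext
      simp only [subtypePerm_apply, mul_apply, hB₁, hA₂, hτ₁ k h]
    · have h' := (hp' k).not.2 h
      rw [← hτ₂ k h] at h'
      rw [dif_neg h', dif_neg h]
      apply Subtype.ext
      simp only [subtypePerm_apply, mul_apply, hB₃, hA₁, hτ₂ k h]
  · intro k l _ _ hkl
    apply H.inj
    by_cases h : p k <;> by_cases h' : p l <;> simp only [h, h', dite_true, dite_false,
      Subtype.mk.injEq] at hkl <;> simpa only [H.same] using congrArg β hkl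
  · rintro ⟨d, hd⟩ hfix
    have hfix' : H.exchange (G.exchange d) ≠ d := fun h => hfix (Subtype.ext h)
    have hcut : ¬ (F d ↔ F (ρ d)) := by
      intro h
      apply hfix'
      rw [G.exchange_eq_self (by rw [hψ, h]), H.exchange_eq_self h]
    obtain ⟨k, hk, rfl | rfl⟩ := H.mem_of_not_iff hcut
    · have hpk : p k := ⟨hk, hd⟩
      refine ⟨k, ?_, by rw [dif_pos hpk]⟩
      intro h
      rw [hB₁, hA₂, ← hτ₁ k hpk, h] at hfix'
      exact hfix' rfl
    · have hpk : ¬ p k := fun h => ((H.opposite hk).1.1 hd) h.2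
      refine ⟨k, ?_, by rw [dif_neg hpk]⟩
      intro h
      rw [hB₃, hA₁, ← hτ₂ k hpk, h] at hfix'
      exact hfix' rfl

open Classical in
/-- The sign of the permutation relating two perfect matchings of a plane bipartite graph, in
terms of a set `F` of faces whose boundary is the difference of the matchings. -/
theorem CutPair.sign_eq [Fintype X] [Fintype Y] (H : CutPair ρ β t₁ t₂ F)
    (G : CutPair (c⁻¹ * ρ) γ t₁ (t₂ ∘ σ) F) (hc : ∀ d, F (c d) ↔ F d) :
    sign σ = sign (c.subtypePerm (p := F) hc) *
      (-1) ^ (Fintype.card {x // ∃ d, F d ∧ β d = x} + Fintype.card {y // ∃ d, F d ∧ γ d = y}) := by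
  -- Both sides restrict `ρ * G.exchange`, as `H.exchange` is an involution.
  have h1 : c.subtypePerm (p := F) hc *
      ((c⁻¹ * ρ) * G.exchange).subtypePerm (p := F) G.apply_exchange_iff =
      (ρ * H.exchange).subtypePerm (p := F) H.apply_exchange_iff *
      (H.exchange * G.exchange).subtypePerm (p := F) (H.exchange_mul_exchange_iff G hc) := by
    ext d
    have h2 : c * ((c⁻¹ * ρ) * G.exchange) = (ρ * H.exchange) * (H.exchange * G.exchange) := by
      rw [mul_assoc ρ, ← mul_assoc H.exchange, H.exchange_mul_self]
      group
    exact DFunLike.congr_fun h2 d.1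
  have h3 := congrArg sign h1
  rw [Perm.sign_mul, Perm.sign_mul, H.sign_exchange, G.sign_exchange, H.sign_exchange_mul_exchange G hc] at h3
  have h4 : ∀ n x y : ℕ, ∀ s f : ℤˣ, f * (-1) ^ (n + y) = (-1) ^ (n + x) * s →
      s = f * (-1) ^ (x + y) := by
    intro n x y s f h
    have h5 : ((-1 : ℤˣ) ^ (n + x)) * (-1) ^ (n + x) = 1 := by
      rw [← pow_add, Even.neg_one_pow ⟨_, rfl⟩]
    have h6 : s = (-1) ^ (n + x) * (f * (-1) ^ (n + y)) := by
      rw [h, ← mul_assoc, h5, one_mul]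
    rw [h6, mul_left_comm, ← pow_add]
    have : n + x + (n + y) = 2 * n + (x + y) := by ring
    rw [this, pow_add, pow_mul]
    simp
  exact h4 _ _ _ _ _ h3

end Double

/-! ### Cycles and boundaries mod 2 on a spherical map -/

/-- The fixed functions of a fixed-point free involution. -/
theorem finrank_invariant_of_involutive {E : Type*} [Fintype E] (c : Perm E)
    (hc : ∀ d, c (c d) = d) (hne : ∀ d, c d ≠ d) (V : Submodule (ZMod 2) (E → ZMod 2))
    (hV : ∀ f, f ∈ V ↔ ∀ d, f (c d) = f d) : 2 * Module.finrank (ZMod 2) V = Fintype.card E := by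
  let T : (E → ZMod 2) →ₗ[ZMod 2] (E → ZMod 2) :=
    { toFun := fun f d => f (c d) + f d
      map_add' := fun f g => by ext d; simp only [Pi.add_apply]; ring
      map_smul' := fun a f => by ext d; simp only [Pi.smul_apply, smul_eq_mul, RingHom.id_apply]; ring }
  have hadd : ∀ a b : ZMod 2, a + b = 0 ↔ a = b := by decide
  have hker : LinearMap.ker T = V := by
    ext f
    rw [hV, LinearMap.mem_ker, funext_iff]
    exact forall_congr' fun d => hadd _ _
  -- `V` is both kernel and image of `1 + c`: an invariant function is the image of its restriction
  -- to one point `O` of each orbit.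
  have hrange : LinearMap.range T = V := by
    ext f
    rw [hV, LinearMap.mem_range]
    constructor
    · rintro ⟨g, rfl⟩ d
      change g (c (c d)) + g (c d) = g (c d) + g d
      rw [hc, add_comm]
    · intro hf
      classical
      obtain ⟨O, hO⟩ : ∃ O : E → Prop, ∀ d, O (c d) ↔ ¬ O d := by
        let e := Fintype.equivFin E
        refine ⟨fun d => e d < e (c d), fun d => ?_⟩
        have : e (c d) ≠ e d := fun h => hne d (e.injective h)
        simp only [hc, not_lt]
        exact ⟨le_of_lt, fun h => lt_of_le_of_ne h this⟩
      refine ⟨fun d => if O d then f d else 0, ?_⟩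
      ext d
      change (if O (c d) then f (c d) else 0) + (if O d then f d else 0) = f d
      by_cases h : O d <;> simp [hO, h, hf]
  have := T.finrank_range_add_finrank_ker
  rw [hker, hrange, Module.finrank_fintype_fun_eq_card] at this
  omega

theorem finrank_le_one_of_forall_eq {k J : Type*} [Field k] [Finite J] [Nonempty J]
    (V : Submodule k (J → k)) (hV : ∀ f ∈ V, ∀ i j, f i = f j) : Module.finrank k V ≤ 1 := by
  have hle : V ≤ Submodule.span k {fun _ => 1} := by
    intro f hf
    rw [Submodule.mem_span_singleton]
    obtain ⟨j⟩ := ‹Nonempty J›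
    refine ⟨f j, ?_⟩
    ext i
    simp [hV f hf i j]
  exact (Submodule.finrank_mono hle).trans (finrank_span_le_card _ |>.trans (by simp))

theorem sum_fiber_comp {E J A : Type*} [Fintype E] [DecidableEq J] [AddCommMonoid A] (f : E → A)
    (π : Perm E) (q : E → J) (hq : ∀ d, q (π d) = q d) (v : J) :
    ∑ d with q d = v, f (π d) = ∑ d with q d = v, f d := by
  rw [Finset.sum_filter, Finset.sum_filter,
    ← Equiv.sum_comp π (fun d => if q d = v then f d else 0)]
  simp only [hq]

/-- On a connected bipartite map of Euler characteristic two every even set of edges bounds. -/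
theorem exists_boundary {E B W : Type*} [Fintype E] [Fintype B] [Fintype W] [Nonempty E]
    (ρ c : Perm E) (hc : ∀ d, c (c d) = d) (hne : ∀ d, c d ≠ d) (b : E → B) (w : E → W)
    (hb : ∀ d, b (ρ d) = b d) (hw : ∀ d, w ((ρ⁻¹ * c) d) = w d)
    (hbs : Function.Surjective b) (hws : Function.Surjective w)
    (hconn : ∀ f : E → ZMod 2, (∀ d, f (ρ d) = f d) → (∀ d, f (c d) = f d) → ∀ d e, f d = f e)
    (hχ : 2 * (Fintype.card B + Fintype.card W) = Fintype.card E + 4)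
    (x : E → ZMod 2) [DecidableEq B] [DecidableEq W]
    (hxb : ∀ v, ∑ d with b d = v, x d = 0) (hxw : ∀ v, ∑ d with w d = v, x d = 0) :
    ∃ f : E → ZMod 2, (∀ d, f (c d) = f d) ∧ ∀ d, x d = f d + f (ρ d) := by
  classical
  have hadd : ∀ a b : ZMod 2, a + b = 0 ↔ a = b := by decide
  -- The incidence matrix of the bipartite graph; its kernel consists of the cycles.
  let M : Matrix (B ⊕ W) E (ZMod 2) :=
    Matrix.of fun v d => Sum.elim (fun v => if b d = v then 1 else 0)
      (fun v => if w d = v then 1 else 0) v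
  have hM₁ : ∀ y v, M.mulVec y (.inl v) = ∑ d with b d = v, y d := by
    intro y v
    simp [M, Matrix.mulVec, dotProduct, Finset.sum_filter]
  have hM₂ : ∀ y v, M.mulVec y (.inr v) = ∑ d with w d = v, y d := by
    intro y v
    simp [M, Matrix.mulVec, dotProduct, Finset.sum_filter]
  have hMt : ∀ g d, M.transpose.mulVec g d = g (.inl (b d)) + g (.inr (w d)) := by
    intro g d
    simp [M, Matrix.mulVec, dotProduct, Fintype.sum_sum_type]
  obtain ⟨d₀⟩ := ‹Nonempty E›
  have : Nonempty E := ⟨d₀⟩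
  have : Nonempty (B ⊕ W) := ⟨.inl (b d₀)⟩
  have hkert : Module.finrank (ZMod 2) (LinearMap.ker M.transpose.mulVecLin) ≤ 1 := by
    apply finrank_le_one_of_forall_eq
    intro g hg
    have hg' : ∀ d, g (.inl (b d)) = g (.inr (w d)) := by
      intro d
      rw [← hadd, ← hMt]
      exact congrFun hg d
    have hconst := hconn (fun d => g (.inl (b d))) (fun d => by simp only [hb]) (fun d => by
      have h1 : c d = ρ ((ρ⁻¹ * c) d) := by simp
      rw [h1, hb, hg', hw, hg'])
    have hall : ∀ v, g v = g (.inl (b d₀)) := by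
      rintro (v | v)
      · obtain ⟨d, rfl⟩ := hbs v
        exact hconst _ _
      · obtain ⟨d, rfl⟩ := hws v
        rw [← hg']
        exact hconst _ _
    intro i j
    rw [hall, hall j]
  -- The boundary map, applied below to `c`-invariant functions, that is, to sets of faces.
  let S : (E → ZMod 2) →ₗ[ZMod 2] (E → ZMod 2) :=
    { toFun := fun f d => f d + f (ρ d)
      map_add' := fun f g => by ext d; simp only [Pi.add_apply]; ring
      map_smul' := fun a f => by ext d; simp only [Pi.smul_apply, smul_eq_mul, RingHom.id_apply]; ring }
  let V : Submodule (ZMod 2) (E → ZMod 2) :=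
    { carrier := {f | ∀ d, f (c d) = f d}
      add_mem' := fun {f g} hf hg d => by simp only [Pi.add_apply, hf d, hg d]
      zero_mem' := fun d => rfl
      smul_mem' := fun a f hf d => by simp only [Pi.smul_apply, hf d] }
  have hVdim := finrank_invariant_of_involutive c hc hne V (fun f => Iff.rfl)
  have hkerS : Module.finrank (ZMod 2) (LinearMap.ker (S.domRestrict V)) ≤ 1 := by
    have h1 : Module.finrank (ZMod 2) (LinearMap.ker (S.domRestrict V)) =
        Module.finrank (ZMod 2) ((LinearMap.ker (S.domRestrict V)).map V.subtype) :=
      (LinearEquiv.finrank_eq (Submodule.equivMapOfInjective _ V.injective_subtype _))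
    rw [h1]
    apply finrank_le_one_of_forall_eq
    rintro _ ⟨f, hf, rfl⟩
    refine hconn _ (fun d => ?_) f.2
    have := congrFun hf d
    exact ((hadd _ _).1 this).symm
  have hle : LinearMap.range (S.domRestrict V) ≤ LinearMap.ker M.mulVecLin := by
    rintro _ ⟨⟨f, hf⟩, rfl⟩
    rw [LinearMap.mem_ker]
    ext v
    rcases v with v | v
    · change M.mulVec (S f) (.inl v) = 0
      rw [hM₁]
      change ∑ d with b d = v, (f d + f (ρ d)) = 0
      rw [Finset.sum_add_distrib, sum_fiber_comp f ρ b hb, hadd]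
    · change M.mulVec (S f) (.inr v) = 0
      rw [hM₂]
      change ∑ d with w d = v, (f d + f (ρ d)) = 0
      rw [Finset.sum_add_distrib, hadd, ← sum_fiber_comp (fun d => f (ρ d)) (ρ⁻¹ * c) w hw]
      refine Finset.sum_congr rfl fun d _ => ?_
      have h1 : ρ ((ρ⁻¹ * c) d) = c d := by simp
      rw [h1, hf]
  have e1 := (S.domRestrict V).finrank_range_add_finrank_ker
  have e2 := M.mulVecLin.finrank_range_add_finrank_ker
  have e3 := M.transpose.mulVecLin.finrank_range_add_finrank_ker
  have e4 : Module.finrank (ZMod 2) (LinearMap.range M.transpose.mulVecLin) =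
      Module.finrank (ZMod 2) (LinearMap.range M.mulVecLin) := M.rank_transpose
  rw [Module.finrank_fintype_fun_eq_card] at e2 e3
  rw [Fintype.card_sum] at e3
  -- By `hχ`, cycles have dimension at most `E - (B + W) + 1 = E / 2 - 1`, and boundaries at least
  -- `E / 2 - 1`.
  have heq := Submodule.eq_of_le_of_finrank_le hle (by omega)
  have hx : x ∈ LinearMap.ker M.mulVecLin := by
    rw [LinearMap.mem_ker]
    ext v
    rcases v with v | v
    · exact (hM₁ x v).trans (hxb v)
    · exact (hM₂ x v).trans (hxw v)
  rw [← heq] at hx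
  obtain ⟨⟨f, hf⟩, hfx⟩ := hx
  exact ⟨f, hf, fun d => (congrFun hfx d).symm⟩

/-! ### Kasteleyn's sign formula -/

theorem card_subtype_eq_add_of_injective {K X : Type*} [Fintype K] [Fintype X] (ι : K → X)
    (hι : Function.Injective ι) (P : X → Prop) [DecidablePred P]
    [DecidablePred fun x => P x ∧ x ∉ Set.range ι] :
    Fintype.card {x // P x} =
      Fintype.card {k // P (ι k)} + Fintype.card {x // P x ∧ x ∉ Set.range ι} := by
  classical
  rw [← Fintype.card_sum]
  refine (Fintype.card_congr (Equiv.ofBijective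
    (Sum.elim (fun k => ⟨ι k.1, k.2⟩) (fun x => ⟨x.1, x.2.1⟩)) ⟨?_, ?_⟩)).symm
  · rintro (k | x) (l | y) h <;> simp only [Sum.elim_inl, Sum.elim_inr, Subtype.mk.injEq] at h
    · exact congrArg _ (Subtype.ext (hι h))
    · exact absurd ⟨_, h⟩ y.2.2
    · exact absurd ⟨_, h.symm⟩ x.2.2
    · exact congrArg _ (Subtype.ext h)
  · rintro ⟨x, hx⟩
    by_cases h : x ∈ Set.range ι
    · obtain ⟨k, rfl⟩ := h
      exact ⟨.inl ⟨k, hx⟩, rfl⟩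
    · exact ⟨.inr ⟨x, hx, h⟩, rfl⟩

namespace Equiv.Perm

/-- The sign of an involution that exchanges a set with its complement. -/
theorem sign_of_involutive {S : Type*} [Fintype S] [DecidableEq S] (c : Perm S)
    (hc : ∀ d, c (c d) = d) (O : S → Prop) [DecidablePred O] (hO : ∀ d, O (c d) ↔ ¬ O d) :
    sign c = (-1) ^ Fintype.card {d // O d} := by
  have h1 := sign_of_fibers c (X := {d // O d})
    (fun d => if h : O d then ⟨d, h⟩ else ⟨c d, (hO d).2 h⟩) ?_ ?_
  · have h2 : Fintype.card {d // ¬ O d} = Fintype.card {d // O d} :=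
      Fintype.card_congr (c.subtypeEquiv fun d => (hO d).symm)
    have h3 := Fintype.card_subtype_compl (fun d => O d)
    have h4 := Fintype.card_subtype_le (fun d => O d)
    have h5 : Fintype.card S = 2 * Fintype.card {d // O d} := by omega
    rw [h1, pow_add, h5, pow_mul]
    simp
  · rintro ⟨d, hd⟩
    exact ⟨d, dif_pos hd⟩
  · have hpow : ∀ (d : S) (n : ℕ), (c ^ n) d = d ∨ (c ^ n) d = c d := by
      intro d n
      induction n with
      | zero => exact .inl rfl
      | succ n ih =>
        rw [pow_succ', mul_apply]
        rcases ih with h | h <;> rw [h]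
        · exact .inr rfl
        · exact .inl (hc d)
    have hsame : ∀ d e, c.SameCycle d e ↔ e = d ∨ e = c d := by
      intro d e
      constructor
      · intro h
        obtain ⟨n, rfl⟩ := h.exists_nat_pow_eq
        exact hpow d n
      · rintro (rfl | rfl)
        · exact SameCycle.refl _ _
        · exact sameCycle_apply_right.2 (SameCycle.refl _ _)
    intro d e
    rw [hsame]
    by_cases hd : O d <;> by_cases he : O e <;> simp only [hd, he, dite_true, dite_false,
      Subtype.mk.injEq]
    · constructor
      · rintro rfl
        exact .inl rfl
      · rintro (rfl | rfl)
        · rfl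
        · exact absurd hd ((hO d).1 he)
    · constructor
      · intro h
        exact .inr (by rw [h, hc])
      · rintro (rfl | rfl)
        · exact absurd hd he
        · rw [hc]
    · constructor
      · intro h
        exact .inr h.symm
      · rintro (rfl | rfl)
        · exact absurd he hd
        · rfl
    · rw [c.injective.eq_iff]
      constructor
      · rintro rfl
        exact .inl rfl
      · rintro (rfl | rfl)
        · rfl
        · exact absurd ((hO d).2 hd) he

end Equiv.Perm

namespace CutPair

variable {E X Y K : Type*} {ρ c : Perm E} {β : E → X} {γ : E → Y}
  {t₁ t₂ : K → E} {σ : Perm K} {F : E → Prop}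

theorem iff_of_fiber [Finite E] (H : CutPair ρ β t₁ t₂ F) {x : X}
    (hx : ∀ a, β a = x → (F a ↔ F (ρ a))) {d e : E} (hd : β d = x) (he : β e = x) :
    F d ↔ F e := by
  obtain ⟨n, rfl⟩ := ((H.fiber _ _).1 (hd.trans he.symm)).exists_nat_pow_eq
  have key : ∀ n : ℕ, β ((ρ ^ n) d) = x ∧ (F d ↔ F ((ρ ^ n) d)) := by
    intro n
    induction n with
    | zero => exact ⟨hd, Iff.rfl⟩
    | succ n ih =>
      rw [pow_succ', mul_apply, H.β_apply, ← hx _ ih.1]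
      exact ih
  exact (key n).2

theorem iff_of_notMem [Finite E] (H : CutPair ρ β t₁ t₂ F) {d e : E}
    (hd : β d ∉ Set.range fun k => β (t₁ k)) (hde : β d = β e) : F d ↔ F e := by
  refine H.iff_of_fiber (x := β d) (fun a ha => ?_) rfl hde.symm
  rw [H.cut]
  constructor
  · rintro ⟨k, rfl⟩
    exact absurd ⟨k, ha⟩ hd
  · rintro ⟨k, rfl⟩
    exact absurd ⟨k, (H.same k).trans ha⟩ hd

/-- The criterion involves only the edge `t₁ k`, hence is the same for its black and its white end.
This makes the matched vertices cancel in `sign_eq_prod`. -/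
theorem exists_mem_fiber_iff [Finite E] (H : CutPair ρ β t₁ t₂ F) (k : K) :
    (∃ d, F d ∧ β d = β (t₁ k)) ↔ F (t₁ k) ∨ F (ρ (t₁ k)) := by
  constructor
  · rintro ⟨d, hd, hdk⟩
    by_contra! hcon
    have hk : t₁ k = t₂ k := (H.cut_left k).1 (by tauto)
    refine hcon.1 ((H.iff_of_fiber (fun a ha => ?_) hdk rfl).1 hd)
    rw [H.cut]
    constructor
    · rintro ⟨l, rfl⟩
      obtain rfl := H.inj ha
      exact ⟨l, hk.symm⟩
    · rintro ⟨l, rfl⟩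
      obtain rfl := H.inj ((H.same l).trans ha)
      exact ⟨l, hk⟩
  · rintro (h | h)
    · exact ⟨_, h, rfl⟩
    · exact ⟨_, h, H.β_apply _⟩

open Classical in
-- On the right `κ d` occurs once if `d` is in `F` and once if `ρ d` is, so it survives exactly on
-- the boundary of `F`, the difference of the matchings.
theorem prod_weight [Fintype E] [Fintype K] (H : CutPair ρ β t₁ t₂ F) (κ : E → ℤˣ) :
    ∏ k, κ (t₁ k) * κ (t₂ k) = ∏ d with F d, κ d * κ (ρ⁻¹ d) := by
  have h1 : ∀ {t : K → E}, Function.Injective t →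
      ∏ k, κ (t k) = ∏ d, if d ∈ Set.range t then κ d else 1 := by
    intro t ht
    rw [← Finset.prod_filter]
    refine Finset.prod_bij (fun k _ => t k) (by simp) (fun _ _ _ _ h => ht h) ?_ (by simp)
    intro d hd
    simpa using hd
  rw [Finset.prod_mul_distrib, Finset.prod_mul_distrib, h1 H.injective_left,
    h1 H.symm.injective_left, Finset.prod_filter, Finset.prod_filter,
    ← Equiv.prod_comp ρ (fun d => if F d then κ (ρ⁻¹ d) else 1), ← Finset.prod_mul_distrib,
    ← Finset.prod_mul_distrib]
  refine Finset.prod_congr rfl fun d _ => ?_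
  have h2 := H.cut d
  have h3 : ρ⁻¹ (ρ d) = d := by simp
  have h4 : κ d * κ d = 1 := Int.units_mul_self _
  rw [h3]
  by_cases a : F d <;> by_cases b : F (ρ d) <;> by_cases e : d ∈ Set.range t₁ <;>
    by_cases f : d ∈ Set.range t₂ <;> simp only [a, b, e, f, if_true, if_false, h4, mul_one,
      one_mul] <;> simp only [a, b, e, f, iff_true, iff_false, not_true_eq_false] at h2

open Classical in
/-- Kasteleyn's theorem for the sign of the permutation relating two matchings of a plane
bipartite graph.  Each black vertex that is not matched has a distinguished half-edge in `Q`, and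
two white vertices `γ d₁` and `γ d₂` are not matched. -/
theorem sign_eq_prod [Fintype E] [Fintype K] [Fintype X] [Fintype Y]
    (H : CutPair ρ β t₁ t₂ F)
    (G : CutPair (c⁻¹ * ρ) γ t₁ (t₂ ∘ σ) F) (hc : ∀ d, F (c d) ↔ F d) (hcc : ∀ d, c (c d) = d)
    (O Q : E → Prop) [DecidablePred O] [DecidablePred Q] (hO : ∀ d, O (c d) ↔ ¬ O d)
    (κ : E → ℤˣ)
    (hκ : ∀ d, κ d * κ (ρ⁻¹ d) = (if O d then -1 else 1) * (if Q d then -1 else 1))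
    (hQ₁ : ∀ d, Q d → β d ∉ Set.range fun k => β (t₁ k))
    (hQ₂ : ∀ d e, Q d → Q e → β d = β e → d = e)
    (hQ₃ : ∀ d, β d ∉ (Set.range fun k => β (t₁ k)) → ∃ e, Q e ∧ β e = β d)
    (d₁ d₂ : E) (hd : γ d₁ ≠ γ d₂) (hF : F d₁ ↔ F d₂)
    (hγ : ∀ y, y ∉ (Set.range fun k => γ (t₁ k)) ↔ y = γ d₁ ∨ y = γ d₂) :
    sign σ = ∏ k, κ (t₁ k) * κ (t₂ k) := by
  classical
  have hX := card_subtype_eq_add_of_injective (fun k => β (t₁ k)) H.inj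
    (fun x => ∃ d, F d ∧ β d = x)
  have hY := card_subtype_eq_add_of_injective (fun k => γ (t₁ k)) G.inj
    (fun y => ∃ d, F d ∧ γ d = y)
  have hψ : ∀ d, F ((c⁻¹ * ρ) d) ↔ F (ρ d) := by
    intro d
    rw [← hc, ← mul_apply, mul_inv_cancel_left]
  simp only [H.exists_mem_fiber_iff] at hX
  simp only [G.exists_mem_fiber_iff, hψ] at hY
  have hXQ : Fintype.card {x // (∃ d, F d ∧ β d = x) ∧ x ∉ Set.range fun k => β (t₁ k)} =
      Fintype.card {d : {d // F d} // Q d.1} := by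
    symm
    refine Fintype.card_congr (Equiv.ofBijective
      (fun d => ⟨β d.1.1, ⟨d.1.1, d.1.2, rfl⟩, hQ₁ _ d.2⟩) ⟨?_, ?_⟩)
    · intro d e h
      exact Subtype.ext (Subtype.ext (hQ₂ _ _ d.2 e.2 (congrArg Subtype.val h)))
    · rintro ⟨_, ⟨d, hd, rfl⟩, hx⟩
      obtain ⟨e, he, hed⟩ := hQ₃ d hx
      exact ⟨⟨⟨e, (H.iff_of_notMem hx hed.symm).1 hd⟩, he⟩, Subtype.ext hed⟩
  -- The cycle of an unmatched vertex lies in `F` or outside it, and `hF` treats both unmatched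
  -- white vertices alike.
  have hYm : Even (Fintype.card
      {y // (∃ d, F d ∧ γ d = y) ∧ y ∉ Set.range fun k => γ (t₁ k)}) := by
    have hm₁ := (hγ (γ d₁)).2 (.inl rfl)
    have hm₂ := (hγ (γ d₂)).2 (.inr rfl)
    have h1 : ∀ y, ((∃ d, F d ∧ γ d = y) ∧ y ∉ Set.range fun k => γ (t₁ k)) ↔
        F d₁ ∧ (y = γ d₁ ∨ y = γ d₂) := by
      intro y
      rw [hγ]
      refine and_congr_left ?_
      rintro (rfl | rfl)
      · exact ⟨fun ⟨d, h, h'⟩ => (G.iff_of_notMem hm₁ h'.symm).2 h, fun h => ⟨_, h, rfl⟩⟩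
      · rw [hF]
        exact ⟨fun ⟨d, h, h'⟩ => (G.iff_of_notMem hm₂ h'.symm).2 h, fun h => ⟨_, h, rfl⟩⟩
    simp only [h1]
    by_cases h : F d₁
    · have : Fintype.card {y // F d₁ ∧ (y = γ d₁ ∨ y = γ d₂)} = 2 := by
        rw [Fintype.card_subtype, ← Finset.card_pair hd]
        congr 1
        ext y
        simp [h]
      rw [this]
      exact even_two
    · have : IsEmpty {y // F d₁ ∧ (y = γ d₁ ∨ y = γ d₂)} := ⟨fun y => h y.2.1⟩
      rw [Fintype.card_eq_zero]
      exact Even.zero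
  have hsign := sign_of_involutive (c.subtypePerm (p := F) hc) (fun d => Subtype.ext (hcc d))
    (fun d => O d.1) (fun d => hO d.1)
  have hprod : ∏ d with F d, κ d * κ (ρ⁻¹ d) =
      (-1) ^ (Fintype.card {d : {d // F d} // O d.1} +
        Fintype.card {d : {d // F d} // Q d.1}) := by
    rw [Finset.prod_congr rfl fun d _ => hκ d, Finset.prod_mul_distrib, pow_add]
    have h1 : ∀ (R : E → Prop) [DecidablePred R], ∏ d with F d, (if R d then (-1 : ℤˣ) else 1) =
        (-1) ^ Fintype.card {d : {d // F d} // R d.1} := by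
      intro R _
      rw [Finset.prod_subtype (p := F) _ (by simp), ← Finset.prod_filter, Finset.prod_const,
        Fintype.card_subtype]
    rw [h1, h1]
  rw [H.sign_eq G hc, hsign, H.prod_weight, hprod, hX, hY, hXQ,
    add_add_add_comm, pow_add, Even.neg_one_pow ⟨_, rfl⟩, one_mul, pow_add, pow_add,
    hYm.neg_one_pow, mul_one]

end CutPair

/-! ### The blown-up diagram -/

namespace CircleCompass

/-- The counterclockwise rotation of the corners around a circle crossing. -/
def rot : Perm CircleCompass where
  toFun
    | north => west
    | west => east
    | east => north
  invFun
    | north => east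
    | west => north
    | east => west
  left_inv i := by cases i <;> rfl
  right_inv i := by cases i <;> rfl

theorem sameCycle_rot (i j : CircleCompass) : rot.SameCycle i j := by
  have h : ∀ j, rot.SameCycle north j := by
    rintro (_ | _ | _)
    · exact ⟨0, rfl⟩
    · exact ⟨1, rfl⟩
    · exact ⟨2, rfl⟩
  exact (h i).symm.trans (h j)

instance : Fintype CircleCompass := ⟨⟨[north, west, east], by simp⟩, by rintro (_ | _ | _) <;> simp⟩

theorem sum_univ {A : Type*} [AddCommMonoid A] (f : CircleCompass → A) :
    ∑ i, f i = f north + f west + f east := by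
  change Finset.sum ⟨[north, west, east], _⟩ f = _
  simp [Finset.sum, add_assoc]

end CircleCompass

/-- A map that follows `π` along `τ` sends cycles into cycles. -/
theorem Equiv.Perm.SameCycle.map_of_forall {S T : Type*} [Finite S] {τ : Perm S} {π : Perm T}
    {r : S → T} (h : ∀ s, π.SameCycle (r s) (r (τ s))) {s s' : S} (hs : τ.SameCycle s s') :
    π.SameCycle (r s) (r s') := by
  obtain ⟨n, rfl⟩ := hs.exists_nat_pow_eq
  clear hs
  induction n with
  | zero => exact SameCycle.refl _ _
  | succ n ih =>
    rw [pow_succ', mul_apply]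
    exact ih.trans (h _)

namespace GraphDiagram

variable (D : GraphDiagram.{u})

/-- Half-edges at the vertices of the graph. -/
def AtVertex (h : D.Dart) : Prop := D.kind (D.node h) = .vertex

variable {D} in
theorem node_eq_iff {h h' : D.Dart} : D.node h = D.node h' ↔ D.rot.SameCycle h h' :=
  Quotient.eq

variable {D} in
theorem face_eq_iff {h h' : D.Dart} :
    D.face h = D.face h' ↔ (D.rot⁻¹ * D.flip).SameCycle h h' :=
  Quotient.eq

@[simp] theorem node_rot (h : D.Dart) : D.node (D.rot h) = D.node h :=
  node_eq_iff.2 (sameCycle_apply_left.2 (SameCycle.refl _ _))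

@[simp] theorem node_rot_inv (h : D.Dart) : D.node (D.rot⁻¹ h) = D.node h := by
  rw [← D.node_rot (D.rot⁻¹ h), ← mul_apply, mul_inv_cancel, one_apply]

theorem face_next (h : D.Dart) : D.face ((D.rot⁻¹ * D.flip) h) = D.face h :=
  face_eq_iff.2 (sameCycle_apply_left.2 (SameCycle.refl _ _))

theorem atVertex_rot (h : D.Dart) : D.AtVertex (D.rot h) ↔ D.AtVertex h := by
  rw [AtVertex, node_rot, AtVertex]

theorem atVertex_rot_inv (h : D.Dart) : D.AtVertex (D.rot⁻¹ h) ↔ D.AtVertex h := by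
  rw [AtVertex, node_rot_inv, AtVertex]

/-- The half-edges of the diagram obtained by replacing each vertex by its circle.  A crossing of
the circle with the edge of `h` has three half-edges, named after the corners that follow them
counterclockwise: `east` is the half-edge of the edge of `h`, `north` is the arc to the crossing
with `D.rot h`, and `west` is the arc to the crossing with `D.rot⁻¹ h`. -/
abbrev BlowDart : Type u :=
  {h : D.Dart // ¬ D.AtVertex h} ⊕ ({h : D.Dart // D.AtVertex h} × CircleCompass)

open Classical in
instance : Fintype D.BlowDart := inferInstance

/-- The crossings of the diagram in which the vertices are replaced by circles. -/
abbrev BlowNode : Type u := {v : D.Node // D.kind v ≠ .vertex} ⊕ {h : D.Dart // D.AtVertex h}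

open Classical in
instance : Fintype D.Node := Fintype.ofFinite _

open Classical in
instance : Fintype D.Face := Fintype.ofFinite _

open Classical in
instance : Fintype D.Region := by
  unfold Region
  infer_instance

variable {D}

namespace BlowDart

/-- The rotation around the crossings of the blown-up diagram. -/
def rot : Perm D.BlowDart :=
  Equiv.sumCongr (D.rot.subtypePerm fun h => (D.atVertex_rot h).not)
    (Equiv.prodCongr (Equiv.refl _) CircleCompass.rot)

open Classical in
/-- The half-edge of the blown-up diagram that lies on a given half-edge of the diagram. -/
def outer (h : D.Dart) : D.BlowDart :=
  if hv : D.AtVertex h then .inr (⟨h, hv⟩, .east) else .inl ⟨h, hv⟩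

theorem outer_of_atVertex {h : D.Dart} (hv : D.AtVertex h) :
    outer h = .inr (⟨h, hv⟩, .east) := dif_pos hv

theorem outer_of_not_atVertex {h : D.Dart} (hv : ¬ D.AtVertex h) : outer h = .inl ⟨h, hv⟩ :=
  dif_neg hv

/-- The other half of an edge of the blown-up diagram. -/
def flipFun : D.BlowDart → D.BlowDart
  | .inl h => outer (D.flip h.1)
  | .inr (h, .east) => outer (D.flip h.1)
  | .inr (h, .north) => .inr (⟨D.rot h.1, (D.atVertex_rot _).2 h.2⟩, .west)
  | .inr (h, .west) => .inr (⟨D.rot⁻¹ h.1, (D.atVertex_rot_inv _).2 h.2⟩, .north)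

theorem flipFun_outer (h : D.Dart) : flipFun (outer h) = outer (D.flip h) := by
  by_cases hv : D.AtVertex h
  · rw [outer_of_atVertex hv]; rfl
  · rw [outer_of_not_atVertex hv]; rfl

theorem flipFun_involutive : Function.Involutive (flipFun (D := D)) := by
  rintro (⟨h, hv⟩ | ⟨⟨h, hv⟩, _ | _ | _⟩)
  · change flipFun (outer (D.flip h)) = _
    rw [flipFun_outer, D.flip_flip, outer_of_not_atVertex hv]
  · simp only [flipFun]
    congr
    simp
  · simp only [flipFun]
    congr
    simp
  · change flipFun (outer (D.flip h)) = _
    rw [flipFun_outer, D.flip_flip, outer_of_atVertex hv]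

/-- The involution of the half-edges of the blown-up diagram. -/
def flip : Perm D.BlowDart := flipFun_involutive.toPerm

theorem flip_flip (d : D.BlowDart) : flip (flip d) = d := flipFun_involutive d

theorem flip_outer (h : D.Dart) : flip (outer h) = outer (D.flip h) := flipFun_outer h

/-- The crossing of a half-edge of the blown-up diagram. -/
def node : D.BlowDart → D.BlowNode
  | .inl h => .inl ⟨D.node h.1, h.2⟩
  | .inr (h, _) => .inr h

/-- The region that contains the corner following a half-edge of the blown-up diagram. -/
def region : D.BlowDart → D.Region
  | .inl h => .inl (D.face h.1)
  | .inr (h, .north) => .inr ⟨D.node h.1, h.2⟩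
  | .inr (h, .west) => .inl (D.face (D.rot⁻¹ h.1))
  | .inr (h, .east) => .inl (D.face h.1)

theorem region_outer (h : D.Dart) : region (outer h) = .inl (D.face h) := by
  by_cases hv : D.AtVertex h
  · rw [outer_of_atVertex hv]; rfl
  · rw [outer_of_not_atVertex hv]; rfl

theorem node_rot (d : D.BlowDart) : node (rot d) = node d := by
  rcases d with ⟨h, hv⟩ | ⟨⟨h, hv⟩, i⟩
  · exact congrArg Sum.inl (Subtype.ext (D.node_rot h))
  · rfl

theorem node_eq_iff (d e : D.BlowDart) : node d = node e ↔ (rot (D := D)).SameCycle d e := by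
  constructor
  · rcases d with ⟨h, hv⟩ | ⟨⟨h, hv⟩, i⟩ <;> rcases e with ⟨h', hv'⟩ | ⟨⟨h', hv'⟩, i'⟩ <;>
      simp only [node, Sum.inl.injEq, Sum.inr.injEq, Subtype.mk.injEq, reduceCtorEq, false_imp_iff]
    · intro hh
      have h1 : (D.rot.subtypePerm fun h => (D.atVertex_rot h).not).SameCycle
          (⟨h, hv⟩ : {h // ¬ D.AtVertex h}) ⟨h', hv'⟩ :=
        sameCycle_subtypePerm.2 (GraphDiagram.node_eq_iff.1 (congrArg Subtype.val hh))
      exact h1.map_of_forall (r := fun x => (Sum.inl x : D.BlowDart)) fun s =>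
        sameCycle_apply_right.2 (SameCycle.refl rot (Sum.inl s : D.BlowDart))
    · rintro rfl
      exact (CircleCompass.sameCycle_rot i i').map_of_forall
        (r := fun j => (Sum.inr (⟨h, hv⟩, j) : D.BlowDart)) fun s =>
          sameCycle_apply_right.2 (SameCycle.refl rot (Sum.inr (⟨h, hv⟩, s) : D.BlowDart))
  · intro hde
    obtain ⟨n, rfl⟩ := hde.exists_nat_pow_eq
    clear hde
    induction n with
    | zero => rfl
    | succ n ih => rw [pow_succ', mul_apply, node_rot, ← ih]

theorem rot_inv_east (h : {h : D.Dart // D.AtVertex h}) :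
    rot⁻¹ (.inr (h, .east) : D.BlowDart) = .inr (h, .west) := rfl

theorem rot_inv_west (h : {h : D.Dart // D.AtVertex h}) :
    rot⁻¹ (.inr (h, .west) : D.BlowDart) = .inr (h, .north) := rfl

theorem rot_inv_north (h : {h : D.Dart // D.AtVertex h}) :
    rot⁻¹ (.inr (h, .north) : D.BlowDart) = .inr (h, .east) := rfl

theorem rot_inv_inl (h : {h : D.Dart // ¬ D.AtVertex h}) :
    rot⁻¹ (.inl h : D.BlowDart) = .inl ⟨D.rot⁻¹ h.1, (D.atVertex_rot_inv _).not.2 h.2⟩ := rfl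

theorem flip_north (h : {h : D.Dart // D.AtVertex h}) :
    flip (.inr (h, .north) : D.BlowDart) =
      .inr (⟨D.rot h.1, (D.atVertex_rot _).2 h.2⟩, .west) := rfl

theorem flip_west (h : {h : D.Dart // D.AtVertex h}) :
    flip (.inr (h, .west) : D.BlowDart) =
      .inr (⟨D.rot⁻¹ h.1, (D.atVertex_rot_inv _).2 h.2⟩, .north) := rfl

theorem region_next (d : D.BlowDart) : region ((rot⁻¹ * flip : Perm D.BlowDart) d) = region d := by
  have key : ∀ h : D.Dart, region ((rot⁻¹ * flip : Perm D.BlowDart) (outer h)) = region (outer h) := by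
    intro h
    rw [mul_apply, flip_outer, region_outer, ← D.face_next h, mul_apply]
    by_cases hv : D.AtVertex (D.flip h)
    · rw [outer_of_atVertex hv, rot_inv_east]; rfl
    · rw [outer_of_not_atVertex hv, rot_inv_inl]; rfl
  rcases d with ⟨h, hv⟩ | ⟨⟨h, hv⟩, _ | _ | _⟩
  · rw [← outer_of_not_atVertex hv, key]
  · rw [mul_apply, flip_north, rot_inv_west]
    exact congrArg Sum.inr (Subtype.ext (D.node_rot h))
  · rw [mul_apply, flip_west, rot_inv_north]; rfl
  · rw [← outer_of_atVertex hv, key]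

/-- One step along a face of the diagram is one step in the blown-up diagram, or two at a vertex,
where an arc of the circle is passed as well. -/
theorem sameCycle_outer {h h' : D.Dart} (hh : D.face h = D.face h') :
    (rot⁻¹ * flip : Perm D.BlowDart).SameCycle (outer h) (outer h') := by
  refine (face_eq_iff.1 hh).map_of_forall fun s => ?_
  by_cases hv : D.AtVertex (D.flip s)
  · refine ⟨2, ?_⟩
    change rot⁻¹ (flip (rot⁻¹ (flip (outer s)))) = _
    rw [flip_outer, outer_of_atVertex hv, rot_inv_east, flip_west, rot_inv_north,
      outer_of_atVertex]
    rfl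
  · refine ⟨1, ?_⟩
    change rot⁻¹ (flip (outer s)) = _
    rw [flip_outer, outer_of_not_atVertex hv, rot_inv_inl, outer_of_not_atVertex]
    rfl

/-- A half-edge either is in the cycle of an outer one of the same face, or is a `north` one; at a
vertex the `north` ones are permuted like the half-edges under `D.rot`. -/
theorem region_eq_iff (d e : D.BlowDart) :
    region d = region e ↔ (rot⁻¹ * flip : Perm D.BlowDart).SameCycle d e := by
  constructor
  · have h1 : ∀ d : D.BlowDart,
        (∃ h, region d = .inl (D.face h) ∧ (rot⁻¹ * flip : Perm D.BlowDart).SameCycle d (outer h)) ∨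
        ∃ h, d = .inr (h, .north) := by
      rintro (⟨h, hv⟩ | ⟨⟨h, hv⟩, _ | _ | _⟩)
      · exact .inl ⟨h, rfl, by rw [outer_of_not_atVertex hv]⟩
      · exact .inr ⟨_, rfl⟩
      · refine .inl ⟨D.rot⁻¹ h, rfl, 1, ?_⟩
        rw [outer_of_atVertex ((D.atVertex_rot_inv _).2 hv)]
        rfl
      · exact .inl ⟨h, rfl, by rw [outer_of_atVertex hv]⟩
    rcases h1 d with ⟨h, hd, hd'⟩ | ⟨⟨h, hv⟩, rfl⟩ <;>
      rcases h1 e with ⟨h', he, he'⟩ | ⟨⟨h', hv'⟩, rfl⟩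
    · rw [hd, he]
      intro hh
      exact hd'.trans ((sameCycle_outer (Sum.inl_injective hh)).trans he'.symm)
    · rw [hd]
      simp [region]
    · rw [he]
      simp [region]
    · intro hh
      have hh' : D.node h = D.node h' := congrArg Subtype.val (Sum.inr_injective hh)
      have h2 : (D.rot.subtypePerm fun h => (D.atVertex_rot h)).SameCycle
          (⟨h, hv⟩ : {h // D.AtVertex h}) ⟨h', hv'⟩ :=
        sameCycle_subtypePerm.2 (GraphDiagram.node_eq_iff.1 hh')
      refine h2.map_of_forall (r := fun x => (Sum.inr (x, .north) : D.BlowDart)) fun s => ⟨1, ?_⟩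
      rfl
  · intro hde
    obtain ⟨n, rfl⟩ := hde.exists_nat_pow_eq
    clear hde
    induction n with
    | zero => rfl
    | succ n ih => rw [pow_succ', mul_apply, region_next, ← ih]

open Classical in
/-- A function on the blown-up half-edges, extended by zero: the value at a corner of the circle
crossing of `h`, the corner `east` standing for `h` itself if it is not at a vertex. -/
def extend {A : Type*} [Zero A] (x : D.BlowDart → A) (i : CircleCompass) (h : D.Dart) : A :=
  if hv : D.AtVertex h then x (.inr (⟨h, hv⟩, i)) else
    match i with
    | .east => x (.inl ⟨h, hv⟩)
    | _ => 0

open Classical in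
theorem sum_eq {A : Type*} [AddCommMonoid A] (x : D.BlowDart → A) :
    ∑ d, x d = ∑ h, (extend x .north h + extend x .west h + extend x .east h) := by
  have h1 : ∑ d, x d = ∑ d : {h : D.Dart // ¬ D.AtVertex h}, x (.inl d) +
      ∑ d : {h : D.Dart // D.AtVertex h} × CircleCompass, x (.inr d) :=
    Fintype.sum_sum_type x
  rw [h1, Fintype.sum_prod_type, ← Fintype.sum_subtype_add_sum_subtype D.AtVertex, add_comm]
  congr 1
  · refine Finset.sum_congr rfl fun h _ => ?_
    rw [CircleCompass.sum_univ]
    simp [extend, h.2]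
  · refine Finset.sum_congr rfl fun h _ => ?_
    simp [extend, h.2]

end BlowDart

end GraphDiagram

/-! ### Boundaries in the blown-up diagram -/

namespace GraphDiagram

variable {D : GraphDiagram.{u}}

theorem eq_of_invariant {A : Type*} (f : D.Dart → A) (hr : ∀ d, f (D.rot d) = f d)
    (hf : ∀ d, f (D.flip d) = f d) (d e : D.Dart) : f d = f e := by
  obtain ⟨⟨g, hg⟩, rfl⟩ := D.connected.exists_smul_eq d e
  change f d = f (g d)
  induction hg using Subgroup.closure_induction generalizing d with
  | mem g hg =>
    rcases hg with rfl | rfl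
    · exact (hr d).symm
    · exact (hf d).symm
  | one => rfl
  | mul g k _ _ hg hk =>
    rw [mul_apply, ← hg, ← hk]
  | inv g _ hg =>
    rw [hg (g⁻¹ d), ← mul_apply, mul_inv_cancel, one_apply]

namespace BlowDart

theorem extend_of_atVertex {A : Type*} [Zero A] (x : D.BlowDart → A) (i : CircleCompass)
    {h : D.Dart} (hv : D.AtVertex h) : extend x i h = x (.inr (⟨h, hv⟩, i)) :=
  dif_pos hv

theorem extend_east {A : Type*} [Zero A] (x : D.BlowDart → A) (h : D.Dart) :
    extend x .east h = x (outer h) := by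
  by_cases hv : D.AtVertex h
  · rw [extend_of_atVertex x _ hv, outer_of_atVertex hv]
  · rw [outer_of_not_atVertex hv]
    exact dif_neg hv

theorem extend_north_of_not {A : Type*} [Zero A] (x : D.BlowDart → A) {h : D.Dart}
    (hv : ¬ D.AtVertex h) : extend x .north h = 0 := dif_neg hv

theorem extend_west_of_not {A : Type*} [Zero A] (x : D.BlowDart → A) {h : D.Dart}
    (hv : ¬ D.AtVertex h) : extend x .west h = 0 := dif_neg hv

open Classical in
-- The `west` corner at `D.rot h` lies in the sector after `h`, so both corners are recorded at `h`.
-- This collapses an even set of corners of the blown-up diagram to sectors of the original one.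
theorem sum_region_face (x : D.BlowDart → ZMod 2) (f : D.Face) :
    ∑ d with region d = .inl f, x d =
      ∑ h with D.face h = f, (x (outer h) + extend x .west (D.rot h)) := by
  rw [Finset.sum_filter, sum_eq, Finset.sum_add_distrib, Finset.sum_add_distrib,
    Finset.sum_filter]
  have h1 : ∀ h : D.Dart,
      extend (fun d => if region d = .inl f then x d else 0) .north h = 0 := by
    intro h
    by_cases hv : D.AtVertex h
    · rw [extend_of_atVertex _ _ hv]
      simp [region]
    · exact extend_north_of_not _ hv
  have h2 : ∀ h : D.Dart, extend (fun d => if region d = .inl f then x d else 0) .west h =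
      if D.face (D.rot⁻¹ h) = f then extend x .west h else 0 := by
    intro h
    by_cases hv : D.AtVertex h
    · rw [extend_of_atVertex _ _ hv, extend_of_atVertex _ _ hv]
      exact if_congr Sum.inl_injective.eq_iff rfl rfl
    · rw [extend_west_of_not _ hv, extend_west_of_not _ hv, ite_self]
  have h3 : ∀ h : D.Dart, extend (fun d => if region d = .inl f then x d else 0) .east h =
      if D.face h = f then x (outer h) else 0 := by
    intro h
    rw [extend_east, region_outer]
    exact if_congr Sum.inl_injective.eq_iff rfl rfl
  simp only [h1, h2, h3, Finset.sum_const_zero, zero_add]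
  rw [← Equiv.sum_comp D.rot, ← Finset.sum_add_distrib]
  refine Finset.sum_congr rfl fun h _ => ?_
  have h4 : D.rot⁻¹ (D.rot h) = h := by simp
  rw [h4]
  split_ifs
  · rw [add_comm]
  · simp

open Classical in
theorem sum_region_circle (x : D.BlowDart → ZMod 2) (v : {v : D.Node // D.kind v = .vertex}) :
    ∑ d with region d = .inr v, x d = ∑ h with D.node h = v, extend x .north h := by
  rw [Finset.sum_filter, sum_eq, Finset.sum_filter]
  refine Finset.sum_congr rfl fun h _ => ?_
  by_cases hv : D.AtVertex h
  · rw [extend_of_atVertex _ _ hv, extend_of_atVertex _ _ hv, extend_of_atVertex _ _ hv,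
      extend_of_atVertex _ _ hv,
      if_neg (c := region (.inr (⟨h, hv⟩, .west)) = .inr v) Sum.inl_ne_inr,
      if_neg (c := region (.inr (⟨h, hv⟩, .east)) = .inr v) Sum.inl_ne_inr, add_zero, add_zero]
    exact if_congr (Sum.inr_injective.eq_iff.trans Subtype.ext_iff) rfl rfl
  · rw [extend_north_of_not _ hv, extend_west_of_not _ hv, extend_east, region_outer,
      extend_north_of_not _ hv]
    simp

open Classical in
theorem sum_node (x : D.BlowDart → ZMod 2) (v : D.Node) (hv : D.kind v ≠ .vertex) :
    ∑ d with node d = .inl ⟨v, hv⟩, x d =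
      ∑ h with D.node h = v, (x (outer h) + extend x .west (D.rot h)) := by
  rw [Finset.sum_filter, sum_eq, Finset.sum_filter]
  refine Finset.sum_congr rfl fun h _ => ?_
  by_cases hh : D.AtVertex h
  · rw [extend_of_atVertex _ _ hh, extend_of_atVertex _ _ hh, extend_of_atVertex _ _ hh,
      if_neg (c := D.node h = v) (fun h' => hv (by rw [← h']; exact hh))]
    simp [node]
  · rw [extend_north_of_not _ hh, extend_west_of_not _ hh, extend_east,
      extend_west_of_not _ ((D.atVertex_rot h).not.2 hh), outer_of_not_atVertex hh,
      add_zero, zero_add, add_zero]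
    exact if_congr (Sum.inl_injective.eq_iff.trans Subtype.ext_iff) rfl rfl

open Classical in
theorem sum_circle (x : D.BlowDart → ZMod 2) (h : {h : D.Dart // D.AtVertex h}) :
    ∑ d with node d = .inr h, x d =
      x (.inr (h, .north)) + x (.inr (h, .west)) + x (.inr (h, .east)) := by
  rw [Finset.sum_filter, sum_eq, Finset.sum_eq_single h.1]
  · rw [extend_of_atVertex _ _ h.2, extend_of_atVertex _ _ h.2, extend_of_atVertex _ _ h.2]
    simp [node]
  · intro h' _ hne
    by_cases hv : D.AtVertex h'
    · rw [extend_of_atVertex _ _ hv, extend_of_atVertex _ _ hv, extend_of_atVertex _ _ hv]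
      have : (⟨h', hv⟩ : {h : D.Dart // D.AtVertex h}) ≠ h := fun e => hne (congrArg Subtype.val e)
      simp [node, this]
    · rw [extend_north_of_not _ hv, extend_west_of_not _ hv, extend_east,
        outer_of_not_atVertex hv]
      simp [node]
  · simp

open Classical in
/-- Every even set of corners of the blown-up diagram is a boundary. -/
theorem exists_boundary [Nonempty D.Dart] (x : D.BlowDart → ZMod 2)
    (hn : ∀ v, ∑ d with node d = v, x d = 0) (hr : ∀ r, ∑ d with region d = r, x d = 0) :
    ∃ f : D.BlowDart → ZMod 2, (∀ d, f (flip d) = f d) ∧ ∀ d, x d = f d + f (rot d) := by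
  have hcirc : ∀ h : {h : D.Dart // D.AtVertex h},
      x (.inr (h, .north)) + x (.inr (h, .west)) + x (.inr (h, .east)) = 0 := fun h => by
    rw [← sum_circle]; exact hn _
  have hadd : ∀ a b : ZMod 2, a + b = 0 → a = b := by decide
  -- The collapsed set is even at a vertex too: by `hcirc`, its sum there equals that of the `north`
  -- corners in the circle region.
  obtain ⟨f, hf, hfx⟩ := _root_.exists_boundary D.rot D.flip D.flip_flip D.flip_ne D.node D.face
    D.node_rot D.face_next Quotient.mk_surjective Quotient.mk_surjective
    eq_of_invariant
    (by
      have := D.spherical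
      simpa only [Nat.card_eq_fintype_card] using this)
    (fun h => x (outer h) + extend x .west (D.rot h))
    (by
      intro v
      by_cases hv : D.kind v = .vertex
      · rw [Finset.sum_add_distrib, sum_fiber_comp (extend x .west) D.rot D.node D.node_rot,
          ← Finset.sum_add_distrib, ← hr (.inr ⟨v, hv⟩), sum_region_circle]
        refine Finset.sum_congr rfl fun h hh => ?_
        have hv' : D.AtVertex h := by
          rw [AtVertex, (Finset.mem_filter.1 hh).2]
          exact hv
        rw [extend_of_atVertex _ _ hv', extend_of_atVertex _ _ hv', outer_of_atVertex hv']
        have := hcirc ⟨h, hv'⟩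
        rw [add_assoc] at this
        rw [hadd _ _ this, add_comm]
      · rw [← sum_node x v hv]
        exact hn _)
    (fun f => by rw [← sum_region_face]; exact hr _)
  have hrot : ∀ h (hv : D.AtVertex h), f h + f (D.rot h) =
      x (.inr (⟨h, hv⟩, .east)) + x (.inr (⟨D.rot h, (D.atVertex_rot h).2 hv⟩, .west)) := by
    intro h hv
    rw [← hfx, extend_of_atVertex _ _ ((D.atVertex_rot h).2 hv), outer_of_atVertex hv]
  -- The values on the arcs are forced by `x` and by `f` on the outer edges; by `hrot` they agree at
  -- both ends of an arc.
  let F : D.BlowDart → ZMod 2 := fun d => match d with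
    | .inl h => f h.1
    | .inr (h, .north) => f h.1 + x (.inr (h, .east))
    | .inr (h, .west) => f h.1 + x (.inr (h, .west))
    | .inr (h, .east) => f h.1
  have hFo : ∀ h : D.Dart, F (outer h) = f h := by
    intro h
    by_cases hv : D.AtVertex h
    · rw [outer_of_atVertex hv]
    · rw [outer_of_not_atVertex hv]
  have hFn : ∀ h : {h : D.Dart // D.AtVertex h},
      F (.inr (⟨D.rot h.1, (D.atVertex_rot _).2 h.2⟩, .west)) = F (.inr (h, .north)) := by
    rintro ⟨h, hv⟩
    change f (D.rot h) + x _ = f h + x _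
    have h1 := hrot h hv
    have h2 : ∀ a b c d : ZMod 2, a + b = c + d → b + d = a + c := by decide
    exact h2 _ _ _ _ h1
  refine ⟨F, ?_, ?_⟩
  · rintro (⟨h, hv⟩ | ⟨⟨h, hv⟩, _ | _ | _⟩)
    · rw [← outer_of_not_atVertex hv, flip_outer, hFo, hFo, hf]
    · rw [flip_north, hFn]
    · rw [flip_west, ← hFn]
      simp
    · rw [← outer_of_atVertex hv, flip_outer, hFo, hFo, hf]
  · have h2 : ∀ a b c e : ZMod 2, b + c + e = 0 → b = (a + e) + (a + c) := by decide
    have h3 : ∀ a b : ZMod 2, b = (a + b) + a := by decide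
    have h4 : ∀ a b : ZMod 2, b = a + (a + b) := by decide
    rintro (⟨h, hv⟩ | ⟨⟨h, hv⟩, _ | _ | _⟩)
    · change _ = f h + f (D.rot h)
      rw [← hfx, outer_of_not_atVertex hv,
        extend_west_of_not _ ((D.atVertex_rot h).not.2 hv), add_zero]
    · exact h2 _ _ _ _ (hcirc _)
    · exact h3 _ _
    · exact h4 _ _

end BlowDart

/-! ### Kasteleyn weights -/

/-- A corner of the diagram as a half-edge of the blown-up diagram. -/
def Corner.toBlowDart : D.Corner → D.BlowDart
  | .inl h => .inl ⟨h.1, fun hv => by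
      have := h.2
      rw [AtVertex] at hv
      rw [AtDouble, hv] at this
      simp at this⟩
  | .inr (h, i) => .inr (⟨h.1, h.2.1⟩, i)

/-- A crossing of the diagram as a crossing of the blown-up diagram. -/
def Crossing.toBlowNode : D.Crossing → D.BlowNode
  | .inl v => .inl ⟨v.1, fun hv => by
      have := v.2
      rw [hv] at this
      simp at this⟩
  | .inr h => .inr ⟨h.1, h.2.1⟩

theorem Crossing.toBlowNode_injective : Function.Injective (Crossing.toBlowNode (D := D)) := by
  rintro (v | h) (v' | h') hh <;>
    simp only [toBlowNode, Sum.inl.injEq, Sum.inr.injEq, Subtype.mk.injEq, reduceCtorEq] at hh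
  · exact congrArg Sum.inl (Subtype.ext hh)
  · have h1 : h.1 = h'.1 := congrArg (fun x : {h : D.Dart // D.AtVertex h} => x.1) hh
    exact congrArg Sum.inr (Subtype.ext h1)

theorem Corner.node_toBlowDart (a : D.Corner) :
    BlowDart.node a.toBlowDart = a.crossing.toBlowNode := by
  rcases a with h | ⟨h, i⟩ <;> rfl

theorem Corner.region_toBlowDart (a : D.Corner) : BlowDart.region a.toBlowDart = a.region := by
  rcases a with h | ⟨h, _ | _ | _⟩ <;> rfl

namespace BlowDart

open Classical in
/-- The Kasteleyn weight. -/
def weight : D.BlowDart → ℤˣ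
  | .inl h => if D.kind (D.node h.1) = .point then 1 else
      match D.compass h.1 with
      | .south => -1
      | _ => 1
  | .inr (h, .north) => if D.out h.1 then -1 else 1
  | .inr (h, .west) => if D.out h.1 then 1 else -1
  | .inr (_, .east) => 1

theorem weight_toBlowDart (a : D.Corner) : weight a.toBlowDart = a.localSign := by
  rcases a with ⟨h, hh⟩ | ⟨⟨h, hh⟩, _ | _ | _⟩
  · have hp : D.kind (D.node h) ≠ .point := by
      intro hp
      rw [AtDouble, hp] at hh
      simp at hh
    simp only [Corner.toBlowDart, weight, Corner.localSign, Corner.M, Corner.m, if_neg hp]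
    cases D.compass h <;> rfl
  · simp [Corner.toBlowDart, weight, Corner.localSign, Corner.M, Corner.m, hh.2]
  · simp [Corner.toBlowDart, weight, Corner.localSign, Corner.M, Corner.m, hh.2]
  · simp [Corner.toBlowDart, weight, Corner.localSign, Corner.M, Corner.m]

/-- A choice of one half of each edge of the blown-up diagram. -/
def Half : D.BlowDart → Prop
  | .inl h => D.out h.1 = false
  | .inr (_, .north) => False
  | .inr (_, .west) => True
  | .inr (h, .east) => D.out h.1 = false

/-- A half-edge at each crossing of the blown-up diagram that is not a crossing of the diagram. -/
def Extra : D.BlowDart → Prop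
  | .inl h => D.kind (D.node h.1) = .point ∧ D.out h.1 = false
  | .inr (h, .north) => D.out h.1 = true
  | .inr (_, _) => False

theorem half_outer (h : D.Dart) : Half (outer h) ↔ D.out h = false := by
  by_cases hv : D.AtVertex h
  · rw [outer_of_atVertex hv]; rfl
  · rw [outer_of_not_atVertex hv]; rfl

theorem half_flip (d : D.BlowDart) : Half (flip d) ↔ ¬ Half d := by
  have key : ∀ h : D.Dart, Half (flip (outer h)) ↔ ¬ Half (outer h) := by
    intro h
    rw [flip_outer, half_outer, half_outer, D.out_flip]
    simp
  rcases d with ⟨h, hv⟩ | ⟨⟨h, hv⟩, _ | _ | _⟩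
  · rw [← outer_of_not_atVertex hv, key]
  · rw [flip_north]; simp [Half]
  · rw [flip_west]; simp [Half]
  · rw [← outer_of_atVertex hv, key]

theorem out_rot_rot_of_double {h : D.Dart} (hh : D.AtDouble h) :
    D.out (D.rot (D.rot h)) = !D.out h := (D.double_spec h hh).2

open Classical in
-- Around a node each weight occurs in two products, so the half-edges in `Half` and those in
-- `Extra` are together even in number. `Half` holds twice at double points and entering circle
-- crossings, but once at leaving ones and ordinary points, where `Extra` compensates.
theorem weight_mul_weight (d : D.BlowDart) : weight d * weight (rot⁻¹ d) =
    (if Half d then -1 else 1) * (if Extra d then -1 else 1) := by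
  rcases d with ⟨h, hv⟩ | ⟨⟨h, hv⟩, _ | _ | _⟩
  · rw [rot_inv_inl]
    by_cases hp : D.kind (D.node h) = .point
    · cases ho : D.out h <;> simp only [weight, Half, Extra, D.node_rot_inv, hp, ho] <;> simp
    · have hd : D.AtDouble (D.rot⁻¹ h) := by
        rw [AtDouble, node_rot_inv]
        rw [AtVertex] at hv
        cases hk : D.kind (D.node h) <;> simp_all
      have h1 := out_rot_rot_of_double hd
      have h2 : D.rot (D.rot⁻¹ h) = h := by simp
      rw [h2] at h1
      cases ho : D.out h <;> cases ho' : D.out (D.rot⁻¹ h) <;>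
        simp only [weight, Half, Extra, D.node_rot_inv, hp, compass, h2, h1, ho, ho'] <;> simp
  · rw [rot_inv_north]
    cases ho : D.out h <;> simp [weight, Half, Extra, ho]
  · rw [rot_inv_west]
    cases ho : D.out h <;> simp [weight, Half, Extra, ho]
  · rw [rot_inv_east]
    cases ho : D.out h <;> simp [weight, Half, Extra, ho]

theorem Extra.node_ne {d : D.BlowDart} (hd : Extra d) (C : D.Crossing) :
    C.toBlowNode ≠ node d := by
  rcases d with ⟨h, hv⟩ | ⟨⟨h, hv⟩, _ | _ | _⟩
  · rcases C with ⟨v, hv⟩ | C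
    · intro hh
      have hh' : v = D.node h := congrArg Subtype.val (Sum.inl_injective hh)
      rw [hh', hd.1] at hv
      simp at hv
    · exact Sum.inr_ne_inl
  · rcases C with C | ⟨h', hv'⟩
    · exact Sum.inl_ne_inr
    · intro hh
      have hh' : h' = h := congrArg Subtype.val (Sum.inr_injective hh)
      rw [EntersVertex, hh'] at hv'
      have ho : D.out h = true := hd
      rw [hv'.2] at ho
      simp at ho
  · exact hd.elim
  · exact hd.elim

theorem Extra.unique {d e : D.BlowDart} (hd : Extra d) (he : Extra e) (hde : node d = node e) :
    d = e := by
  rcases d with ⟨h, hv⟩ | ⟨h, _ | _ | _⟩ <;> rcases e with ⟨h', hv'⟩ | ⟨h', _ | _ | _⟩ <;>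
    first | exact hd.elim | exact he.elim | skip
  · have hh : D.node h = D.node h' := congrArg Subtype.val (Sum.inl_injective hde)
    obtain ⟨n, hn⟩ := (GraphDiagram.node_eq_iff.1 hh).exists_nat_pow_eq
    have h1 := D.point_spec h hd.1
    have h2 : ∀ n : ℕ, (D.rot ^ n) h = h ∨ (D.rot ^ n) h = D.rot h := by
      intro n
      induction n with
      | zero => exact .inl rfl
      | succ n ih =>
        rw [pow_succ', mul_apply]
        rcases ih with h' | h' <;> rw [h']
        · exact .inr rfl
        · exact .inl h1.1
    rcases h2 n with h3 | h3
    · rw [hn] at h3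
      subst h3
      rfl
    · rw [hn] at h3
      have h4 : D.out h' = false := he.2
      have h5 : D.out h = false := hd.2
      rw [h3, h1.2, h5] at h4
      simp at h4
  · cases hde
  · cases hde
  · rw [Sum.inr_injective hde]

theorem exists_extra (d : D.BlowDart) (hd : ∀ C : D.Crossing, C.toBlowNode ≠ node d) :
    ∃ e : D.BlowDart, Extra e ∧ node e = node d := by
  rcases d with ⟨h, hv⟩ | ⟨⟨h, hv⟩, i⟩
  · have hp : D.kind (D.node h) = .point := by
      cases hk : D.kind (D.node h)
      · exact absurd hk hv
      · exact absurd rfl (hd (.inl ⟨_, .inl hk⟩))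
      · exact absurd rfl (hd (.inl ⟨_, .inr hk⟩))
      · rfl
    cases ho : D.out h
    · exact ⟨.inl ⟨h, hv⟩, ⟨hp, ho⟩, rfl⟩
    · refine ⟨rot (.inl ⟨h, hv⟩), ⟨?_, ?_⟩, node_rot _⟩
      · change D.kind (D.node (D.rot h)) = _
        rw [D.node_rot, hp]
      · change D.out (D.rot h) = _
        rw [(D.point_spec h hp).2, ho]
        rfl
  · refine ⟨.inr (⟨h, hv⟩, .north), ?_, rfl⟩
    change D.out h = true
    by_contra ho
    exact hd (.inr ⟨h, hv, by simpa using ho⟩) rfl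

end BlowDart

end GraphDiagram

/-! ### States as matchings -/

theorem sum_fiber_indicator {E X K : Type*} [Fintype E] [DecidableEq X] (q : E → X) (t : K → E)
    (ht : Function.Injective fun k => q (t k)) [DecidablePred fun d => d ∈ Set.range t] (v : X)
    [Decidable (v ∈ Set.range fun k => q (t k))] :
    ∑ d with q d = v, (if d ∈ Set.range t then (1 : ZMod 2) else 0) =
      if v ∈ Set.range fun k => q (t k) then 1 else 0 := by
  classical
  split_ifs with h
  · obtain ⟨k, rfl⟩ := h
    rw [Finset.sum_eq_single (t k)]
    · simp
    · rintro d hd hne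
      rw [if_neg]
      rintro ⟨l, rfl⟩
      exact hne (congrArg t (ht (Finset.mem_filter.1 hd).2))
    · simp
  · refine Finset.sum_eq_zero fun d hd => if_neg ?_
    rintro ⟨l, rfl⟩
    exact h ⟨l, (Finset.mem_filter.1 hd).2⟩

namespace GraphDiagram

variable {D : GraphDiagram.{u}} {δ : D.Dart}

namespace State

/-- The corners of a state as half-edges of the blown-up diagram. -/
def blow (s : State δ) (C : D.Crossing) : D.BlowDart := (s.corner C).toBlowDart

theorem node_blow (s : State δ) (C : D.Crossing) :
    BlowDart.node (s.blow C) = C.toBlowNode := by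
  rw [blow, Corner.node_toBlowDart, s.crossing_corner]

theorem region_blow (s : State δ) (C : D.Crossing) :
    BlowDart.region (s.blow C) = (s.equiv C).1 :=
  Corner.region_toBlowDart _

theorem node_blow_injective (s : State δ) :
    Function.Injective fun C => BlowDart.node (s.blow C) := by
  intro C C' h
  simp only [node_blow] at h
  exact Crossing.toBlowNode_injective h

theorem region_blow_injective (s : State δ) :
    Function.Injective fun C => BlowDart.region (s.blow C) := by
  intro C C' h
  simp only [region_blow] at h
  exact s.equiv.injective (Subtype.ext h)

theorem notMem_range_region_blow_iff (s : State δ) (r : D.Region) :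
    r ∉ (Set.range fun C => BlowDart.region (s.blow C)) ↔
      r = .inl (D.face δ) ∨ r = .inl (D.face (D.flip δ)) := by
  simp only [region_blow]
  constructor
  · intro h
    by_contra! hr
    exact h ⟨s.equiv.symm ⟨r, hr⟩, congrArg Subtype.val (s.equiv.apply_symm_apply ⟨r, hr⟩)⟩
  · rintro h ⟨C, rfl⟩
    have := (s.equiv C).2
    tauto

open Classical in
/-- The permutation of the crossings relating two states has as sign the product of the local
signs of both states. -/
theorem sign_trans_symm (hδ : D.face δ ≠ D.face (D.flip δ)) (s₁ s₂ : State δ) :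
    Perm.sign (s₁.equiv.trans s₂.equiv.symm) =
      (∏ C, (s₁.corner C).localSign) * ∏ C, (s₂.corner C).localSign := by
  set σ : Perm D.Crossing := s₁.equiv.trans s₂.equiv.symm with hσ
  have : Nonempty D.Dart := ⟨δ⟩
  have hσr : ∀ C, BlowDart.region (s₁.blow C) = BlowDart.region ((s₂.blow ∘ σ) C) := by
    intro C
    simp [region_blow, hσ]
  have hadd : ∀ a : ZMod 2, a + a = 0 := by decide
  -- Both states match the same crossings and regions, so their difference is even everywhere.
  obtain ⟨f, hf, hfx⟩ := BlowDart.exists_boundary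
    (fun d : D.BlowDart => (if d ∈ Set.range s₁.blow then (1 : ZMod 2) else 0) +
      if d ∈ Set.range s₂.blow then 1 else 0)
    (by
      intro v
      rw [Finset.sum_add_distrib, sum_fiber_indicator _ _ s₁.node_blow_injective,
        sum_fiber_indicator _ _ s₂.node_blow_injective]
      simp only [node_blow]
      exact hadd _)
    (by
      intro r
      have h : r ∈ (Set.range fun C => BlowDart.region (s₁.blow C)) ↔
          r ∈ Set.range fun C => BlowDart.region (s₂.blow C) := by
        rw [← not_iff_not, notMem_range_region_blow_iff, notMem_range_region_blow_iff]
      rw [Finset.sum_add_distrib, sum_fiber_indicator _ _ s₁.region_blow_injective,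
        sum_fiber_indicator _ _ s₂.region_blow_injective]
      simp only [h]
      exact hadd _)
  let F : D.BlowDart → Prop := fun d => f d = 1
  have hF : ∀ d, F (BlowDart.flip d) ↔ F d := fun d => by simp only [F, hf]
  have hcut : ∀ d, (F d ↔ F (BlowDart.rot d)) ↔
      (d ∈ Set.range s₁.blow ↔ d ∈ Set.range s₂.blow) := by
    intro d
    have h1 : ∀ a b : ZMod 2, (a = 1 ↔ b = 1) ↔ a + b = 0 := by decide
    rw [h1, ← hfx]
    by_cases h : d ∈ Set.range s₁.blow <;> by_cases h' : d ∈ Set.range s₂.blow <;>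
      simp only [h, h', if_true, if_false] <;> decide
  have H : CutPair BlowDart.rot BlowDart.node s₁.blow s₂.blow F :=
    ⟨BlowDart.node_eq_iff, fun C => by rw [node_blow, node_blow], s₁.node_blow_injective, hcut⟩
  have G : CutPair (BlowDart.flip⁻¹ * BlowDart.rot) BlowDart.region s₁.blow (s₂.blow ∘ σ) F := by
    refine ⟨fun d e => ?_, hσr, s₁.region_blow_injective, fun d => ?_⟩
    · rw [BlowDart.region_eq_iff, ← sameCycle_inv, mul_inv_rev, inv_inv]
    · rw [σ.surjective.range_comp, ← hcut, ← hF ((BlowDart.flip⁻¹ * BlowDart.rot : Perm D.BlowDart) d), ← mul_apply,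
        mul_inv_cancel_left]
  -- The marked regions lie on the two sides of one edge, and `F` contains both halves of an edge or
  -- neither.
  have hconst : F (BlowDart.outer δ) ↔ F (BlowDart.outer (D.flip δ)) := by
    rw [← BlowDart.flip_outer, hF]
  have key := CutPair.sign_eq_prod H G hF BlowDart.flip_flip BlowDart.Half BlowDart.Extra
    BlowDart.half_flip BlowDart.weight BlowDart.weight_mul_weight
    (fun d hd => by
      rintro ⟨C, hC⟩
      exact hd.node_ne C ((node_blow s₁ C).symm.trans hC))
    (fun d e hd he hde => hd.unique he hde)
    (fun d hd => BlowDart.exists_extra d fun C hC => hd ⟨C, (node_blow s₁ C).trans hC⟩)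
    (BlowDart.outer δ) (BlowDart.outer (D.flip δ))
    (by
      rw [BlowDart.region_outer, BlowDart.region_outer]
      exact fun h => hδ (Sum.inl_injective h))
    hconst
    (fun r => by
      rw [notMem_range_region_blow_iff, BlowDart.region_outer, BlowDart.region_outer])
  simp only [blow, BlowDart.weight_toBlowDart, Finset.prod_mul_distrib] at key
  convert key

/-- The numbering of the regions cancels, and that of the crossings only conjugates the permutation
relating the states. -/
theorem sign_mul_sign (hδ : D.face δ ≠ D.face (D.flip δ)) {N : ℕ} (cr : Fin N ≃ D.Crossing)
    (re : Fin N ≃ Unmarked δ) (s₁ s₂ : State δ) :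
    s₁.sign cr re * s₂.sign cr re =
      (∏ C, (s₁.corner C).localSign) * ∏ C, (s₂.corner C).localSign := by
  classical
  rw [← sign_trans_symm hδ, State.sign, State.sign, ← sign_inv (cr.trans s₂.equiv |>.trans re.symm),
    mul_comm, ← Perm.sign_mul, ← sign_trans_trans_symm _ cr]
  congr 1
  ext i
  simp [Perm.mul_apply, Perm.inv_def]

theorem M_mul_m (s : State δ) : s.M * s.m = ∏ C, (s.corner C).localSign :=
  Finset.prod_mul_distrib.symm

end State

end GraphDiagram

end

theorem theoremA1 (D : GraphDiagram) (δ : D.Dart) (hδ : D.face δ ≠ D.face (D.flip δ)) (N : ℕ)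
    (cr : Fin N ≃ D.Crossing) (re : Fin N ≃ GraphDiagram.Unmarked δ) :
    (∀ s₁ s₂ : GraphDiagram.State δ,
      s₁.sign cr re / s₂.sign cr re = (s₁.M * s₁.m) / (s₂.M * s₂.m)) ∧
    ∃ ε : ℤˣ,
      (∀ s : GraphDiagram.State δ, s.sign cr re = ε * ∏ C, (s.corner C).localSign) ∧
      ∀ c : D.Coloring,
        ∑ s : GraphDiagram.State δ, (s.sign cr re : ℤ) • (s.m : ℤ) • s.A c =
          (ε : ℤ) • ∑ s : GraphDiagram.State δ, (s.M : ℤ) • s.A c := by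
  have key := GraphDiagram.State.sign_mul_sign hδ cr re
  have hself : ∀ a : ℤˣ, a * a = 1 := Int.units_mul_self
  refine ⟨fun s₁ s₂ => ?_, ?_⟩
  · rw [s₁.M_mul_m, s₂.M_mul_m, Int.units_div_eq_mul, Int.units_div_eq_mul, key]
  · obtain ⟨ε, hε⟩ : ∃ ε : ℤˣ, ∀ s : GraphDiagram.State δ,
        s.sign cr re = ε * ∏ C, (s.corner C).localSign := by
      by_cases h : Nonempty (GraphDiagram.State δ)
      · obtain ⟨s₀⟩ := h
        refine ⟨s₀.sign cr re * ∏ C, (s₀.corner C).localSign, fun s => ?_⟩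
        rw [mul_assoc, ← key, ← mul_assoc, hself, one_mul]
      -- Without states the first claim is vacuous and both sums are empty, so any sign serves.
      · exact ⟨1, fun s => absurd ⟨s⟩ h⟩
    refine ⟨ε, hε, fun c => ?_⟩
    rw [Finset.smul_sum]
    refine Finset.sum_congr rfl fun s _ => ?_
    have h : s.sign cr re * s.m = ε * s.M := by
      rw [hε, ← s.M_mul_m, mul_assoc, mul_assoc, hself, mul_one]
    rw [smul_smul, smul_smul, ← Units.val_mul, ← Units.val_mul, h]
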